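/- Set multicover with multiplicity constraints: given $A\in\{0,1\}^{n\times m}$ and $b\in\mathbb Z_{\ge 0}^n$, minimize $\langle 1,z\rangle$ subject to $Az\ge b$ and $z\in\{0,1\}^m$. Assume that the instance is feasible, let $\mathrm{OPT}$ be its optimal value and $\mathrm{LP}$ the optimal value of its relaxation to $z\in[0,1]^m$, and assume $mn\ge 2$. In the random-order model $m$ is known and the rows $(a_i,b_i)$ are revealed one at a time in uniformly random order; a (randomized) online algorithm must maintain a coordinatewise non-decreasing $z\in\{0,1\}^m$ that satisfies every row revealed so far. Algorithm LearnOrCoverSMC with parameter $\beta$: start with $x_j=\beta/m$ and $z_j=0$ for all $j$. When row $i$ arrives and $\langle a_i,z\rangle\ge b_i$, do nothing. Otherwise let $T=\{j: z_j=0,\ a_{ij}=1\}$, $X=\sum_{j\in T}x_j$ and $d=b_i-\langle a_i,z\rangle$, all computed from the current $x$ and $z$, and do the following. 1. Independently for each $j$, set $z_j\leftarrow 1$ with probability $\min(1,\,d\,x_j/\beta)$. 2. If $X\le d$: set $z_j\leftarrow 1$ for all $j\in T$ with $x_j\ge 1/e$; then multiply $x_j$ by $e$ for each $j\in T$, and rescale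 $x$ so that $\sum_j x_j=\beta$. 3. If row $i$ is still not satisfied, set $z_j\leftarrow 1$ for $d$ arbitrary elements $j$ of $T$. **Theorem.** (a) There is an absolute constant $C$ such that, for every rule for the arbitrary choices in step 3 (which may depend on everything seen so far), LearnOrCoverSMC maintains a non-decreasing solution satisfying all the rows revealed so far, and, whenever $\mathrm{LP}\le\beta\le 2\,\mathrm{LP}$, its final solution $z$ in the random-order model satisfies $\mathbb E[\langle 1,z\rangle]\le C\log(mn)\cdot\mathrm{OPT}$. (b) There is an $O(\log mn)$-competitive algorithm for the random-order model that is given no such $\beta$: there is an absolute constant $C$ such that for every $m$ there is a randomized online algorithm, knowing only $m$ and the rows revealed so far, whose final solution satisfies $\mathbb E[\langle 1,z\rangle]\le C\log(mn)\cdot\mathrm{OPT}$ for every $n$ with $mn\ge2$ and every feasible instance with $n$ rows. -/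

import Mathlib

open scoped ENNReal

namespace SetMulticover

/-- One covering constraint `∑ j, a j * z j ≥ b` with `a ∈ {0,1}^m` and `b ∈ ℕ`.
The `0/1` row `a` is given by the set `supp = {j | a j = 1}`, and `req = b`. -/
structure Constraint (m : ℕ) where
  supp : Finset (Fin m)
  req : ℕ

/-- A set multicover instance with `n` constraints (the rows of `A z ≥ b`) over `m` columns. -/
abbrev Instance (m n : ℕ) : Type := Fin n → Constraint m

/-- A vector `z ∈ {0,1}^m` is given by the set of the `j` with `z j = 1`. This is `⟨a, z⟩ ≥ b`. -/
def Constraint.CoveredBy {m : ℕ} (c : Constraint m) (z : Finset (Fin m)) : Prop :=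
  c.req ≤ (c.supp ∩ z).card

/-- Feasibility of `z ∈ {0,1}^m` for the integer program `A z ≥ b`. -/
def Feasible {m n : ℕ} (I : Instance m n) (z : Finset (Fin m)) : Prop :=
  ∀ i, (I i).CoveredBy z

/-- The optimal value of the integer program: the least `⟨1, z⟩` of a feasible `z ∈ {0,1}^m`. -/
noncomputable def opt {m n : ℕ} (I : Instance m n) : ℕ :=
  sInf {k : ℕ | ∃ z : Finset (Fin m), Feasible I z ∧ z.card = k}

/-- Feasibility of `x ∈ [0,1]^m` for the linear programming relaxation. -/
def LPFeasible {m n : ℕ} (I : Instance m n) (x : Fin m → ℝ) : Prop :=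
  (∀ j, 0 ≤ x j ∧ x j ≤ 1) ∧ ∀ i, ((I i).req : ℝ) ≤ ∑ j ∈ (I i).supp, x j

/-- The optimal value of the linear programming relaxation. -/
noncomputable def lpOpt {m n : ℕ} (I : Instance m n) : ℝ :=
  sInf {v : ℝ | ∃ x : Fin m → ℝ, LPFeasible I x ∧ ∑ j, x j = v}

/-- A randomized online algorithm for set multicover over `m` columns. It processes the
constraints one at a time, knowing only the constraints revealed so far (through its state),
and after each round holds the current integer solution `sol`. -/
structure OnlineAlg (m : ℕ) where
  State : Type
  start : State
  step : State → Constraint m → PMF State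
  sol : State → Finset (Fin m)

/-- The distribution of the state after processing a list of constraints from state `s`. -/
noncomputable def OnlineAlg.runFrom {m : ℕ} (alg : OnlineAlg m) :
    alg.State → List (Constraint m) → PMF alg.State
  | s, [] => PMF.pure s
  | s, c :: cs => (alg.step s c).bind fun s' => alg.runFrom s' cs

/-- The distribution of the state after processing a list of constraints from the start. -/
noncomputable def OnlineAlg.run {m : ℕ} (alg : OnlineAlg m) (cs : List (Constraint m)) :
    PMF alg.State :=
  alg.runFrom alg.start cs

/-- The algorithm maintains a monotonically increasing solution that satisfies all constraints
revealed so far (whenever these can be satisfied at all), whatever sequence is revealed and with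
probability one. -/
def OnlineAlg.Valid {m : ℕ} (alg : OnlineAlg m) : Prop :=
  (∀ (cs : List (Constraint m)) (c : Constraint m), ∀ s ∈ (alg.run cs).support,
      ∀ s' ∈ (alg.step s c).support, alg.sol s ⊆ alg.sol s') ∧
  (∀ cs : List (Constraint m), (∀ c ∈ cs, c.req ≤ c.supp.card) →
      ∀ s ∈ (alg.run cs).support, ∀ c ∈ cs, c.CoveredBy (alg.sol s))

/-- The final state when the constraints of `I` are revealed in uniformly random order. -/
noncomputable def OnlineAlg.randomOrderRun {m n : ℕ} (alg : OnlineAlg m) (I : Instance m n) :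
    PMF alg.State :=
  (PMF.uniformOfFintype (Equiv.Perm (Fin n))).bind fun σ =>
    alg.run (List.ofFn fun t => I (σ t))

/-- The expected cost `𝔼 ⟨1, z⟩` of the final solution in the random-order model, over the
order of arrival and the random choices of the algorithm. -/
noncomputable def OnlineAlg.expectedCost {m n : ℕ} (alg : OnlineAlg m) (I : Instance m n) :
    ℝ≥0∞ :=
  ∑' s, alg.randomOrderRun I s * ((alg.sol s).card : ℝ≥0∞)

/-- A random subset that contains each `j` independently with probability `min 1 (p j)`. -/
noncomputable def sampleSet {m : ℕ} (p : Fin m → ℝ≥0∞) : PMF (Finset (Fin m)) :=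
  PMF.ofFintype (fun R => (∏ j ∈ R, min 1 (p j)) * ∏ j ∈ Finset.univ \ R, (1 - min 1 (p j))) (by
    have h := Finset.prod_add (fun j => min 1 (p j)) (fun j => 1 - min 1 (p j))
      (Finset.univ : Finset (Fin m))
    rw [Finset.powerset_univ] at h
    rw [← h]
    exact Finset.prod_eq_one fun j _ => add_tsub_cancel_of_le (min_le_left _ _))

/-- The state of LearnOrCoverSMC: the fractional solution `x`, the integer solution `z`, and the
record of the past rounds (arrived constraint and sampled columns, latest round first). The record
is only used to let the arbitrary choice of backup columns depend on everything seen so far. -/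
structure LOCState (m : ℕ) where
  x : Fin m → ℝ
  z : Finset (Fin m)
  hist : List (Constraint m × Finset (Fin m))

/-- A rule for the arbitrary choices: given the record of the rounds up to now, a set `T` and a
number `d`, it names a set of columns. -/
abbrev BackupRule (m : ℕ) : Type :=
  List (Constraint m × Finset (Fin m)) → Finset (Fin m) → ℕ → Finset (Fin m)

/-- The rule chooses `d` elements of `T` whenever `T` has that many. -/
def BackupRule.Admissible {m : ℕ} (backup : BackupRule m) : Prop :=
  ∀ h T d, d ≤ T.card → backup h T d ⊆ T ∧ (backup h T d).card = d

/-- The multiplicative update: multiply `x j` by `e` for `j ∈ T`, then rescale so that the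
coordinates add up to `β`. -/
noncomputable def reweight {m : ℕ} (β : ℝ) (T : Finset (Fin m)) (x : Fin m → ℝ) : Fin m → ℝ :=
  let y : Fin m → ℝ := fun j => x j * Real.exp (if j ∈ T then 1 else 0)
  let Z : ℝ := (∑ j, y j) / β
  fun j => y j / Z

open Classical in
/-- One round of LearnOrCoverSMC. -/
noncomputable def locStep {m : ℕ} (β : ℝ) (backup : BackupRule m) (s : LOCState m)
    (c : Constraint m) : PMF (LOCState m) :=
  if c.CoveredBy s.z then PMF.pure { s with hist := (c, ∅) :: s.hist }
  else
    -- the unbought columns covering `c`, their fractional weight, and the integral undercoverage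
    let T : Finset (Fin m) := c.supp \ s.z
    let X : ℝ := ∑ j ∈ T, s.x j
    let d : ℕ := c.req - (c.supp ∩ s.z).card
    (sampleSet fun j => ENNReal.ofReal ((d : ℝ) * s.x j / β)).map fun R =>
      -- the sampled columns, and in an undercovered round those with large `x j`
      let z₁ : Finset (Fin m) :=
        if X ≤ (d : ℝ) then s.z ∪ R ∪ T.filter (fun j => 1 / Real.exp 1 ≤ s.x j) else s.z ∪ R
      { x := if X ≤ (d : ℝ) then reweight β T s.x else s.x
        z := if c.CoveredBy z₁ then z₁ else z₁ ∪ backup ((c, R) :: s.hist) T d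
        hist := (c, R) :: s.hist }

/-- The algorithm LearnOrCoverSMC with guess `β` for the value of the linear program. -/
noncomputable def learnOrCoverSMC {m : ℕ} (β : ℝ) (backup : BackupRule m) : OnlineAlg m where
  State := LOCState m
  start := { x := fun _ => β / m, z := ∅, hist := [] }
  step := locStep β backup
  sol := LOCState.z

end SetMulticover

namespace SetMulticover

/-! The proof is a potential argument. Call a vector of `coversWithin β cs` a cover. `potential`
adds to the cost so far a learning term (the largest divergence of `x` from a cover of the rows
seen), a covering term `80 β log (1 + ρ)`, where `ρ` is the undercoverage still present in the
unrevealed good rows, and a reserve for later estimates. A row is good if, together with the rows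
seen, it still admits a cover of weight at most `β`. It suffices that the potential does not
increase in expectation when a uniformly random unrevealed row arrives (`expectedCost_le`).

Let a good row arrive with undercoverage `d` and open weight `X`. The round costs at most `5 d` in
expectation. Every cover puts weight at least `d` on the open columns of the row, so the
multiplicative update lowers the divergence by `d - 2 X`; hence five times the learning term changes
by at most `-5 d + 10 min(d, X)` (`learnPotential_locNext_le`). If `X` is small, learning pays for
the round. Otherwise `10 min(d, X)` has to be paid by covering: sampling at intensity `d` lowers the
undercoverage of each good row `k` by at least `d / (4 β) * min(d_k, X_k)` in expectation
(`Regular.le_sum_sampleWeight_min`), so the covering term falls by `20 d M / (1 + ρ)`, with `M` the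
sum of these minima. Random order is used in the average over the arriving row: the debts `10 min(d,
X)` sum to `10 M`, the values `d` sum to `ρ`, and `20 ρ M / (1 + ρ)` is at least `10 M`
(`sum_le_card_mul_potential`).

If `β` is at least the LP value, every row is good, which gives (a). For (b), a bad row starts a new
phase with `β` at least doubled, and the reserve `86 log (1 + mn) (4 LP - 2 β)` pays for the fresh
potentials (`potential_restart_le`). Taking the supremum over covers of the rows seen, and counting
only good rows, is what makes the analysis work while `β` is below the LP value. -/

/-- The expectation of `f` under `p`. -/
noncomputable def expect {α : Type*} (p : PMF α) (f : α → ℝ≥0∞) : ℝ≥0∞ :=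
  ∑' a, p a * f a

/-! ### Expectations with values in `ℝ≥0∞`. -/

section Expect

variable {α γ : Type*}

theorem expect_pure (a : α) (f : α → ℝ≥0∞) : expect (PMF.pure a) f = f a := by
  classical
  unfold expect
  rw [tsum_eq_single a]
  · simp
  · intro b hb
    simp [PMF.pure_apply, hb]

theorem expect_bind (p : PMF α) (g : α → PMF γ) (f : γ → ℝ≥0∞) :
    expect (p.bind g) f = expect p fun a => expect (g a) f := by
  unfold expect
  simp_rw [PMF.bind_apply, ← ENNReal.tsum_mul_right, ← ENNReal.tsum_mul_left, mul_assoc]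
  exact ENNReal.tsum_comm

theorem expect_map (p : PMF α) (g : α → γ) (f : γ → ℝ≥0∞) :
    expect (p.map g) f = expect p fun a => f (g a) := by
  rw [PMF.map, expect_bind]
  simp [expect_pure]

theorem expect_mono {p : PMF α} {f g : α → ℝ≥0∞} (h : ∀ a ∈ p.support, f a ≤ g a) :
    expect p f ≤ expect p g := by
  refine ENNReal.tsum_le_tsum fun a => ?_
  by_cases ha : p a = 0
  · simp [ha]
  · exact mul_le_mul_right (h a ((PMF.mem_support_iff _ _).2 ha)) _

theorem expect_const_mul (p : PMF α) (k : ℝ≥0∞) (f : α → ℝ≥0∞) :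
    expect p (fun a => k * f a) = k * expect p f := by
  unfold expect
  rw [← ENNReal.tsum_mul_left]
  exact tsum_congr fun a => mul_left_comm _ _ _

theorem expect_sum {ι : Type*} (p : PMF α) (t : Finset ι) (f : ι → α → ℝ≥0∞) :
    expect p (fun a => ∑ i ∈ t, f i a) = ∑ i ∈ t, expect p (f i) := by
  unfold expect
  simp_rw [Finset.mul_sum]
  exact Summable.tsum_finsetSum fun i _ => ENNReal.summable

theorem expect_fintype [Fintype α] (p : PMF α) (f : α → ℝ≥0∞) :
    expect p f = ∑ a, p a * f a :=
  tsum_fintype _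

end Expect

/-! ### Random order: from one-step drift to expected cost. -/

namespace OnlineAlg

variable {m : ℕ} (alg : OnlineAlg m)

theorem expect_runFrom_cons (s : alg.State) (c : Constraint m) (cs : List (Constraint m))
    (f : alg.State → ℝ≥0∞) :
    expect (alg.runFrom s (c :: cs)) f =
      expect (alg.step s c) fun s' => expect (alg.runFrom s' cs) f := by
  rw [runFrom, expect_bind]

/-- A function of the state and of the set of unrevealed rows that does not increase in
expectation when a uniformly random unrevealed row arrives bounds the average over all orders. -/
theorem sum_perm_expect_le {N : ℕ} (I : Instance m N) (Inv : alg.State → Prop)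
    (f : alg.State → Finset (Fin N) → ℝ≥0∞)
    (hcost : ∀ s, Inv s → ((alg.sol s).card : ℝ≥0∞) ≤ f s ∅)
    (hinv : ∀ s i, Inv s → ∀ s' ∈ (alg.step s (I i)).support, Inv s')
    (hstep : ∀ s U, Inv s → ∑ i ∈ U, expect (alg.step s (I i)) (fun s' => f s' (U.erase i)) ≤
      U.card * f s U) (k : ℕ) :
    ∀ J : Fin k → Fin N, Function.Injective J → ∀ s, Inv s →
      ∑ σ : Equiv.Perm (Fin k), expect (alg.runFrom s (List.ofFn fun t => I (J (σ t))))
        (fun s' => ((alg.sol s').card : ℝ≥0∞)) ≤ k.factorial * f s (Finset.univ.image J) := by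
  induction k with
  | zero =>
    intro J _ s hs
    simpa [runFrom, expect_pure] using hcost s hs
  | succ k ih =>
    intro J hJ s hs
    -- `J` enumerates the unrevealed rows; `J' p` enumerates those left once `J p` has arrived. The
    -- swap is the one in `Equiv.Perm.decomposeFin`, which splits a permutation into its first value
    -- `p` and a permutation of the rest.
    let J' : Fin (k + 1) → Fin k → Fin N := fun p t => J (Equiv.swap 0 p t.succ)
    have hJ' (p) : Function.Injective (J' p) := fun a b hab =>
      Fin.succ_injective _ ((Equiv.swap 0 p).injective (hJ hab))
    have himage (p) : Finset.univ.image (J' p) = (Finset.univ.image J).erase (J p) := by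
      refine Finset.eq_of_subset_of_card_le (fun i hi => ?_) ?_
      · obtain ⟨t, -, rfl⟩ := Finset.mem_image.1 hi
        refine Finset.mem_erase.2 ⟨fun h => ?_, Finset.mem_image_of_mem _ (Finset.mem_univ _)⟩
        have h1 := hJ h
        have h2 : Equiv.swap 0 p t.succ = Equiv.swap 0 p 0 := by rw [h1, Equiv.swap_apply_left]
        exact Fin.succ_ne_zero t ((Equiv.swap 0 p).injective h2)
      · rw [Finset.card_erase_of_mem (Finset.mem_image_of_mem _ (Finset.mem_univ _)),
          Finset.card_image_of_injective _ hJ, Finset.card_image_of_injective _ (hJ' p)]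
        simp
    calc ∑ σ : Equiv.Perm (Fin (k + 1)), expect (alg.runFrom s (List.ofFn fun t => I (J (σ t))))
          (fun s' => ((alg.sol s').card : ℝ≥0∞))
        = ∑ p : Fin (k + 1), expect (alg.step s (I (J p))) fun s' =>
            ∑ e : Equiv.Perm (Fin k), expect (alg.runFrom s' (List.ofFn fun t => I (J' p (e t))))
              (fun s' => ((alg.sol s').card : ℝ≥0∞)) := by
          rw [← Equiv.sum_comp Equiv.Perm.decomposeFin.symm, Fintype.sum_prod_type]
          refine Finset.sum_congr rfl fun p _ => ?_
          rw [expect_sum]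
          refine Finset.sum_congr rfl fun e _ => ?_
          rw [List.ofFn_succ, expect_runFrom_cons]
          simp only [Equiv.Perm.decomposeFin_symm_apply_zero,
            Equiv.Perm.decomposeFin_symm_apply_succ, J']
      _ ≤ ∑ p : Fin (k + 1), expect (alg.step s (I (J p))) fun s' =>
            k.factorial * f s' ((Finset.univ.image J).erase (J p)) := by
          refine Finset.sum_le_sum fun p _ => expect_mono fun s' hs' => ?_
          rw [← himage]
          exact ih (J' p) (hJ' p) s' (hinv s _ hs s' hs')
      _ = k.factorial * ∑ i ∈ Finset.univ.image J, expect (alg.step s (I i)) fun s' =>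
            f s' ((Finset.univ.image J).erase i) := by
          rw [Finset.sum_image fun a _ b _ h => hJ h, Finset.mul_sum]
          simp_rw [expect_const_mul]
      _ ≤ k.factorial * ((Finset.univ.image J).card * f s (Finset.univ.image J)) :=
          mul_le_mul_right (hstep s _ hs) _
      _ = (k + 1).factorial * f s (Finset.univ.image J) := by
          rw [Finset.card_image_of_injective _ hJ, Finset.card_univ, Fintype.card_fin,
            Nat.factorial_succ]
          push_cast
          ring

theorem expectedCost_le {N : ℕ} (I : Instance m N) (Inv : alg.State → Prop)
    (f : alg.State → Finset (Fin N) → ℝ≥0∞) (hstart : Inv alg.start)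
    (hcost : ∀ s, Inv s → ((alg.sol s).card : ℝ≥0∞) ≤ f s ∅)
    (hinv : ∀ s i, Inv s → ∀ s' ∈ (alg.step s (I i)).support, Inv s')
    (hstep : ∀ s U, Inv s → ∑ i ∈ U, expect (alg.step s (I i)) (fun s' => f s' (U.erase i)) ≤
      U.card * f s U) :
    alg.expectedCost I ≤ f alg.start Finset.univ := by
  have h := alg.sum_perm_expect_le I Inv f hcost hinv hstep N id Function.injective_id
    alg.start hstart
  rw [Finset.image_id] at h
  have hN : (N.factorial : ℝ≥0∞) ≠ 0 := Nat.cast_ne_zero.2 N.factorial_ne_zero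
  have heq : alg.expectedCost I = (N.factorial : ℝ≥0∞)⁻¹ *
      ∑ σ : Equiv.Perm (Fin N), expect (alg.runFrom alg.start (List.ofFn fun t => I (id (σ t))))
        (fun s' => ((alg.sol s').card : ℝ≥0∞)) := by
    change expect (alg.randomOrderRun I) _ = _
    rw [randomOrderRun, expect_bind, expect_fintype, Finset.mul_sum]
    refine Finset.sum_congr rfl fun σ _ => ?_
    rw [PMF.uniformOfFintype_apply, Fintype.card_perm, Fintype.card_fin]
    rfl
  rw [heq]
  calc _ ≤ (N.factorial : ℝ≥0∞)⁻¹ * (N.factorial * f alg.start Finset.univ) :=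
        mul_le_mul_right h _
    _ = _ := by
        rw [← mul_assoc, ENNReal.inv_mul_cancel hN (ENNReal.natCast_ne_top _), one_mul]

end OnlineAlg

/-! ### Independent sampling: moments and truncated means. -/

section Sampling

variable {m : ℕ}

/-- The probability that independent sampling with probabilities `q` returns exactly `R`. -/
def sampleWeight (q : Fin m → ℝ) (R : Finset (Fin m)) : ℝ :=
  (∏ j ∈ R, q j) * ∏ j ∈ Finset.univ \ R, (1 - q j)

theorem sampleWeight_nonneg {q : Fin m → ℝ} (h0 : ∀ j, 0 ≤ q j) (h1 : ∀ j, q j ≤ 1)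
    (R : Finset (Fin m)) : 0 ≤ sampleWeight q R :=
  mul_nonneg (Finset.prod_nonneg fun j _ => h0 j)
    (Finset.prod_nonneg fun j _ => sub_nonneg.2 (h1 j))

theorem sum_sampleWeight_superset (q : Fin m → ℝ) (A : Finset (Fin m)) :
    ∑ R, sampleWeight q R * (if A ⊆ R then 1 else 0) = ∏ j ∈ A, q j := by
  -- Putting 0 in place of `1 - q j` on `A` kills exactly the terms of the expansion whose `R`
  -- misses a point of `A`.
  have h := Finset.prod_add q (fun j => if j ∈ A then 0 else 1 - q j) Finset.univ
  rw [Finset.powerset_univ] at h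
  have h1 : ∏ j, (q j + if j ∈ A then 0 else 1 - q j) = ∏ j ∈ A, q j := by
    rw [← Finset.prod_subset (Finset.subset_univ A)]
    · exact Finset.prod_congr rfl fun j hj => by simp [hj]
    · intro j _ hj
      simp [hj]
  rw [← h1, h]
  refine Finset.sum_congr rfl fun R _ => ?_
  by_cases hA : A ⊆ R
  · simp only [sampleWeight, hA, if_true, mul_one]
    congr 1
    refine Finset.prod_congr rfl fun j hj => ?_
    rw [if_neg fun hjA => (Finset.mem_sdiff.1 hj).2 (hA hjA)]
  · obtain ⟨j, hjA, hjR⟩ := Finset.not_subset.1 hA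
    rw [if_neg hA, mul_zero, Finset.prod_eq_zero (i := j) (s := Finset.univ \ R), mul_zero]
    · simpa using hjR
    · simp [hjA]

theorem sum_sampleWeight (q : Fin m → ℝ) : ∑ R, sampleWeight q R = 1 := by
  simpa using sum_sampleWeight_superset q ∅

/-- Membership is written as `{j} ⊆ R` so that `sum_sampleWeight_superset` gives the moments. -/
theorem card_inter_eq_sum (R S : Finset (Fin m)) :
    ((S ∩ R).card : ℝ) = ∑ j ∈ S, if {j} ⊆ R then 1 else 0 := by
  simp

theorem sum_sampleWeight_card (q : Fin m → ℝ) (S : Finset (Fin m)) :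
    ∑ R, sampleWeight q R * ((S ∩ R).card : ℝ) = ∑ j ∈ S, q j := by
  simp_rw [card_inter_eq_sum, Finset.mul_sum]
  rw [Finset.sum_comm]
  refine Finset.sum_congr rfl fun j _ => ?_
  rw [sum_sampleWeight_superset, Finset.prod_singleton]

theorem sum_sampleWeight_card_sq_le {q : Fin m → ℝ} (h0 : ∀ j, 0 ≤ q j) (S : Finset (Fin m)) :
    ∑ R, sampleWeight q R * ((S ∩ R).card : ℝ) ^ 2 ≤ (∑ j ∈ S, q j) + (∑ j ∈ S, q j) ^ 2 := by
  have hsq (R : Finset (Fin m)) : sampleWeight q R * ((S ∩ R).card : ℝ) ^ 2 =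
      ∑ j ∈ S, ∑ k ∈ S, sampleWeight q R * (if {j, k} ⊆ R then 1 else 0) := by
    rw [card_inter_eq_sum, sq, Finset.sum_mul_sum, Finset.mul_sum]
    refine Finset.sum_congr rfl fun j _ => ?_
    rw [Finset.mul_sum]
    refine Finset.sum_congr rfl fun k _ => ?_
    by_cases hj : j ∈ R <;> by_cases hk : k ∈ R <;> simp [Finset.insert_subset_iff, hj, hk]
  simp_rw [hsq]
  rw [Finset.sum_comm]
  have hpair (j k : Fin m) : ∏ l ∈ ({j, k} : Finset (Fin m)), q l ≤
      q j * q k + if j = k then q j else 0 := by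
    by_cases hjk : j = k
    · subst hjk
      simpa using mul_nonneg (h0 j) (h0 j)
    · simp [Finset.prod_pair hjk, hjk]
  calc ∑ j ∈ S, ∑ R, ∑ k ∈ S, sampleWeight q R * (if {j, k} ⊆ R then 1 else 0)
      = ∑ j ∈ S, ∑ k ∈ S, ∏ l ∈ ({j, k} : Finset (Fin m)), q l := by
        refine Finset.sum_congr rfl fun j _ => ?_
        rw [Finset.sum_comm]
        exact Finset.sum_congr rfl fun k _ => sum_sampleWeight_superset q _
    _ ≤ ∑ j ∈ S, ∑ k ∈ S, (q j * q k + if j = k then q j else 0) :=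
        Finset.sum_le_sum fun j _ => Finset.sum_le_sum fun k _ => hpair j k
    _ = (∑ j ∈ S, q j) + (∑ j ∈ S, q j) ^ 2 := by
        simp_rw [Finset.sum_add_distrib]
        rw [← Finset.sum_mul_sum, ← sq, add_comm]
        congr 1
        refine Finset.sum_congr rfl fun j hj => ?_
        simp [hj]

/-- The truncated number of sampled elements of `S` is in expectation at least half of the
truncated mean. -/
theorem half_min_le_sum_sampleWeight {q : Fin m → ℝ} (h0 : ∀ j, 0 ≤ q j) (h1 : ∀ j, q j ≤ 1)
    (S : Finset (Fin m)) (k : ℕ) :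
    min (k : ℝ) (∑ j ∈ S, q j) / 2 ≤
      ∑ R, sampleWeight q R * min (k : ℝ) ((S ∩ R).card : ℝ) := by
  set μ : ℝ := ∑ j ∈ S, q j with hμ
  have hμ0 : 0 ≤ μ := Finset.sum_nonneg fun j _ => h0 j
  rcases Nat.eq_zero_or_pos k with rfl | hk
  · refine le_trans (by simp [hμ0]) (Finset.sum_nonneg fun R _ =>
      mul_nonneg (sampleWeight_nonneg h0 h1 R) (le_min (by simp) (Nat.cast_nonneg _)))
  have hk1 : (1 : ℝ) ≤ k := by exact_mod_cast hk
  -- Scaling the count by `l` brings its mean down to the truncated mean.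
  obtain ⟨l, hl0, hl1, hlμ⟩ : ∃ l : ℝ, 0 ≤ l ∧ l ≤ 1 ∧ min (k : ℝ) μ = l * μ := by
    rcases le_total μ k with h | h
    · exact ⟨1, zero_le_one, le_rfl, by rw [min_eq_right h, one_mul]⟩
    · have hpos : 0 < μ := by linarith
      exact ⟨k / μ, by positivity, (div_le_one hpos).2 h, by
        rw [min_eq_left h, div_mul_cancel₀ _ hpos.ne']⟩
  -- A parabola in `l * s` lying below the truncation and touching the level `k` at `l * s = 2 k`;
  -- it reduces the claim to the first two moments.
  have hpt (s : ℝ) (hs : 0 ≤ s) : l * s - l ^ 2 * s ^ 2 / (4 * k) ≤ min (k : ℝ) s := by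
    refine le_min ?_ ?_
    · rw [sub_le_iff_le_add, ← sub_le_iff_le_add', le_div_iff₀ (by positivity)]
      nlinarith [sq_nonneg (l * s - 2 * k)]
    · have : 0 ≤ l ^ 2 * s ^ 2 / (4 * k) := by positivity
      nlinarith
  have hlow : l * μ - l ^ 2 / (4 * k) * (μ + μ ^ 2) ≤
      ∑ R, sampleWeight q R * min (k : ℝ) ((S ∩ R).card : ℝ) := by
    calc l * μ - l ^ 2 / (4 * k) * (μ + μ ^ 2)
        ≤ l * (∑ R, sampleWeight q R * ((S ∩ R).card : ℝ)) -
          l ^ 2 / (4 * k) * ∑ R, sampleWeight q R * ((S ∩ R).card : ℝ) ^ 2 := by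
          rw [sum_sampleWeight_card]
          gcongr
          exact sum_sampleWeight_card_sq_le h0 S
      _ = ∑ R, sampleWeight q R * (l * ((S ∩ R).card : ℝ) -
            l ^ 2 * ((S ∩ R).card : ℝ) ^ 2 / (4 * k)) := by
          rw [Finset.mul_sum, Finset.mul_sum, ← Finset.sum_sub_distrib]
          refine Finset.sum_congr rfl fun R _ => ?_
          ring
      _ ≤ _ := Finset.sum_le_sum fun R _ => mul_le_mul_of_nonneg_left
          (hpt _ (Nat.cast_nonneg _)) (sampleWeight_nonneg h0 h1 R)
  refine le_trans ?_ hlow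
  have hM : l * μ ≤ k := hlμ ▸ min_le_left _ _
  have hM0 : 0 ≤ l * μ := mul_nonneg hl0 hμ0
  -- Each of the two terms is at most `l * μ / 4`: the first since `l ≤ 1 ≤ k`, the second since `l
  -- * μ ≤ k`.
  have hkey : l ^ 2 / (4 * k) * (μ + μ ^ 2) ≤ l * μ / 2 := by
    rw [div_mul_eq_mul_div, div_le_iff₀ (by positivity)]
    nlinarith [mul_nonneg hM0 (sub_nonneg.2 hl1), mul_nonneg hM0 (sub_nonneg.2 hM),
      mul_nonneg hM0 (sub_nonneg.2 hk1)]
  rw [hlμ]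
  linarith

theorem sampleSet_apply_ofReal {y : Fin m → ℝ} (h0 : ∀ j, 0 ≤ y j) (R : Finset (Fin m)) :
    sampleSet (fun j => ENNReal.ofReal (y j)) R =
      ENNReal.ofReal (sampleWeight (fun j => min 1 (y j)) R) := by
  have hmin (j) : min 1 (ENNReal.ofReal (y j)) = ENNReal.ofReal (min 1 (y j)) := by
    rw [ENNReal.ofReal_min, ENNReal.ofReal_one]
  have hpos (j) : 0 ≤ min 1 (y j) := le_min zero_le_one (h0 j)
  rw [sampleSet, PMF.ofFintype_apply, sampleWeight,
    ENNReal.ofReal_mul (Finset.prod_nonneg fun j _ => hpos j),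
    ENNReal.ofReal_prod_of_nonneg fun j _ => hpos j,
    ENNReal.ofReal_prod_of_nonneg fun j _ => sub_nonneg.2 (min_le_left _ _)]
  simp_rw [hmin, ENNReal.ofReal_sub _ (hpos _), ENNReal.ofReal_one]

theorem expect_sampleSet_ofReal {y : Fin m → ℝ} (h0 : ∀ j, 0 ≤ y j)
    {g : Finset (Fin m) → ℝ} (hg : ∀ R, 0 ≤ g R) :
    expect (sampleSet fun j => ENNReal.ofReal (y j)) (fun R => ENNReal.ofReal (g R)) =
      ENNReal.ofReal (∑ R, sampleWeight (fun j => min 1 (y j)) R * g R) := by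
  have hw (R) : 0 ≤ sampleWeight (fun j => min 1 (y j)) R :=
    sampleWeight_nonneg (fun j => le_min zero_le_one (h0 j)) (fun j => min_le_left _ _) R
  rw [expect_fintype, ENNReal.ofReal_sum_of_nonneg fun R _ => mul_nonneg (hw R) (hg R)]
  refine Finset.sum_congr rfl fun R _ => ?_
  rw [sampleSet_apply_ofReal h0, ENNReal.ofReal_mul (hw R)]

end Sampling

/-! ### Undercoverage and the linear program. -/

section LinearProgram

variable {m : ℕ}

/-- The amount by which `z` fails to satisfy `c`. -/
def undercoverage (c : Constraint m) (z : Finset (Fin m)) : ℕ :=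
  c.req - (c.supp ∩ z).card

/-- The fractional weight of the columns outside `z` that cover `c`. -/
def openWeight (c : Constraint m) (z : Finset (Fin m)) (x : Fin m → ℝ) : ℝ :=
  ∑ j ∈ c.supp \ z, x j

/-- The vectors in `[0,1]^m` that satisfy all the constraints in the list. -/
def FracCover (cs : List (Constraint m)) (x : Fin m → ℝ) : Prop :=
  (∀ j, 0 ≤ x j ∧ x j ≤ 1) ∧ ∀ c ∈ cs, (c.req : ℝ) ≤ ∑ j ∈ c.supp, x j

/-- The optimal value of the linear program given by a list of constraints. -/
noncomputable def lpValue (cs : List (Constraint m)) : ℝ :=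
  sInf {v : ℝ | ∃ x, FracCover cs x ∧ ∑ j, x j = v}

/-- The fractional covers of total weight at most `β`. -/
def coversWithin (β : ℝ) (cs : List (Constraint m)) : Set (Fin m → ℝ) :=
  {x | FracCover cs x ∧ ∑ j, x j ≤ β}

theorem coveredBy_iff {c : Constraint m} {z : Finset (Fin m)} :
    c.CoveredBy z ↔ undercoverage c z = 0 :=
  Nat.sub_eq_zero_iff_le.symm

theorem undercoverage_le_card {c : Constraint m} (hc : c.req ≤ c.supp.card)
    (z : Finset (Fin m)) : undercoverage c z ≤ (c.supp \ z).card := by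
  have := Finset.card_sdiff_add_card_inter c.supp z
  unfold undercoverage
  omega

theorem undercoverage_anti (c : Constraint m) {z z' : Finset (Fin m)} (h : z ⊆ z') :
    undercoverage c z' ≤ undercoverage c z :=
  Nat.sub_le_sub_left (Finset.card_le_card (Finset.inter_subset_inter_left h)) _

theorem undercoverage_union (c : Constraint m) (z R : Finset (Fin m)) :
    undercoverage c (z ∪ R) =
      undercoverage c z - min (undercoverage c z) ((c.supp \ z) ∩ R).card := by
  have h : (c.supp ∩ (z ∪ R)).card = (c.supp ∩ z).card + ((c.supp \ z) ∩ R).card := by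
    rw [← Finset.card_union_of_disjoint]
    · congr 1
      ext j
      simp only [Finset.mem_inter, Finset.mem_union, Finset.mem_sdiff]
      tauto
    · rw [Finset.disjoint_left]
      intro j
      simp only [Finset.mem_inter, Finset.mem_sdiff]
      tauto
  unfold undercoverage
  omega

theorem openWeight_nonneg (c : Constraint m) (z : Finset (Fin m)) {x : Fin m → ℝ}
    (hx : ∀ j, 0 ≤ x j) : 0 ≤ openWeight c z x :=
  Finset.sum_nonneg fun j _ => hx j

theorem FracCover.tail {c : Constraint m} {cs : List (Constraint m)} {x : Fin m → ℝ}
    (h : FracCover (c :: cs) x) : FracCover cs x :=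
  ⟨h.1, fun c' hc' => h.2 c' (List.mem_cons_of_mem _ hc')⟩

/-- Since `x ≤ 1`, the columns in `z` supply at most their number, so the deficit of `z` must be
supplied from outside `z`. This is where the upper bounds of the relaxation enter. -/
theorem FracCover.undercoverage_le {c : Constraint m} {cs : List (Constraint m)}
    {x : Fin m → ℝ} (h : FracCover cs x) (hc : c ∈ cs) (z : Finset (Fin m)) :
    (undercoverage c z : ℝ) ≤ ∑ j ∈ c.supp \ z, x j := by
  have h1 : ∑ j ∈ c.supp ∩ z, x j ≤ (c.supp ∩ z).card := by
    simpa using Finset.sum_le_card_nsmul (c.supp ∩ z) x 1 fun j _ => (h.1 j).2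
  have h2 := h.2 c hc
  rw [← Finset.sum_inter_add_sum_sdiff c.supp z] at h2
  have h3 : 0 ≤ ∑ j ∈ c.supp \ z, x j := Finset.sum_nonneg fun j _ => (h.1 j).1
  unfold undercoverage
  rcases le_total c.req (c.supp ∩ z).card with h4 | h4
  · rw [Nat.sub_eq_zero_of_le h4]
    simpa using h3
  · rw [Nat.cast_sub h4]
    linarith

theorem FracCover.undercoverage_le_sum {c : Constraint m} {cs : List (Constraint m)}
    {x : Fin m → ℝ} (h : FracCover cs x) (hc : c ∈ cs) (z : Finset (Fin m)) :
    (undercoverage c z : ℝ) ≤ ∑ j, x j :=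
  (h.undercoverage_le hc z).trans
    (Finset.sum_le_sum_of_subset_of_nonneg (Finset.subset_univ _) fun j _ _ => (h.1 j).1)

theorem bddBelow_fracCover (cs : List (Constraint m)) :
    BddBelow {v : ℝ | ∃ x, FracCover cs x ∧ ∑ j, x j = v} :=
  ⟨0, by
    rintro _ ⟨x, hx, rfl⟩
    exact Finset.sum_nonneg fun j _ => (hx.1 j).1⟩

variable {n : ℕ} {I : Instance m n}

theorem bddBelow_lpFeasible (I : Instance m n) :
    BddBelow {v : ℝ | ∃ x : Fin m → ℝ, LPFeasible I x ∧ ∑ j, x j = v} :=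
  ⟨0, by
    rintro _ ⟨x, hx, rfl⟩
    exact Finset.sum_nonneg fun j _ => (hx.1 j).1⟩

theorem LPFeasible.fracCover {x : Fin m → ℝ} (h : LPFeasible I x) {cs : List (Constraint m)}
    (hcs : ∀ c ∈ cs, ∃ i, c = I i) : FracCover cs x :=
  ⟨h.1, fun c hc => by
    obtain ⟨i, rfl⟩ := hcs c hc
    exact h.2 i⟩

theorem Feasible.req_le {z : Finset (Fin m)} (h : Feasible I z) (i : Fin n) :
    (I i).req ≤ (I i).supp.card :=
  (h i).trans (Finset.card_le_card Finset.inter_subset_left)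

theorem Feasible.lpFeasible {z : Finset (Fin m)} (h : Feasible I z) :
    LPFeasible I (fun j => if j ∈ z then 1 else 0) := by
  refine ⟨fun j => ?_, fun i => ?_⟩
  · dsimp only
    split_ifs <;> norm_num
  · rw [Finset.sum_ite_mem, Finset.sum_const, nsmul_one]
    exact_mod_cast h i

theorem Feasible.lpOpt_le {z : Finset (Fin m)} (h : Feasible I z) : lpOpt I ≤ z.card :=
  csInf_le (bddBelow_lpFeasible I) ⟨_, h.lpFeasible, by simp⟩

theorem exists_feasible_card_eq_opt (h : ∃ z, Feasible I z) :
    ∃ z, Feasible I z ∧ z.card = opt I :=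
  Nat.sInf_mem (s := {k : ℕ | ∃ z : Finset (Fin m), Feasible I z ∧ z.card = k})
    (h.imp' Finset.card fun z hz => ⟨z, hz, rfl⟩)

theorem lpOpt_le_opt (h : ∃ z, Feasible I z) : lpOpt I ≤ opt I := by
  obtain ⟨z, hz, hcard⟩ := exists_feasible_card_eq_opt h
  exact hcard ▸ hz.lpOpt_le

theorem lpOpt_le_columns (h : ∃ z, Feasible I z) : lpOpt I ≤ m := by
  obtain ⟨z, hz⟩ := h
  exact hz.lpOpt_le.trans (by exact_mod_cast (Finset.card_le_univ z).trans_eq (Fintype.card_fin m))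

/-- The feasible region is a closed subset of the cube, so the minimum is attained. -/
theorem exists_lpFeasible_sum_eq_lpOpt (h : ∃ z, Feasible I z) :
    ∃ x, LPFeasible I x ∧ ∑ j, x j = lpOpt I := by
  obtain ⟨z, hz⟩ := h
  have hne : {x : Fin m → ℝ | LPFeasible I x}.Nonempty := ⟨_, hz.lpFeasible⟩
  have hclosed : IsClosed {x : Fin m → ℝ | LPFeasible I x} := by
    simp only [LPFeasible, Set.ofPred_and, Set.ofPred_forall]
    refine IsClosed.inter (isClosed_iInter fun j => IsClosed.inter ?_ ?_)
      (isClosed_iInter fun i => ?_)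
    · exact isClosed_le continuous_const (continuous_apply j)
    · exact isClosed_le (continuous_apply j) continuous_const
    · exact isClosed_le continuous_const (continuous_finsetSum _ fun j _ => continuous_apply j)
  have hcompact : IsCompact {x : Fin m → ℝ | LPFeasible I x} :=
    (isCompact_Icc (a := (0 : Fin m → ℝ)) (b := 1)).of_isClosed_subset hclosed
      fun x hx => ⟨fun j => (hx.1 j).1, fun j => (hx.1 j).2⟩
  obtain ⟨x, hx, hmin⟩ := hcompact.exists_isMinOn hne
    (f := fun x => ∑ j, x j) (by fun_prop)
  refine ⟨x, hx, le_antisymm (le_csInf ⟨_, x, hx, rfl⟩ ?_)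
    (csInf_le (bddBelow_lpFeasible I) ⟨x, hx, rfl⟩)⟩
  rintro _ ⟨y, hy, rfl⟩
  exact hmin hy

theorem req_eq_zero_of_opt_eq_zero (h : ∃ z, Feasible I z) (h0 : opt I = 0) (i : Fin n) :
    (I i).req = 0 := by
  obtain ⟨z, hz, hcard⟩ := exists_feasible_card_eq_opt h
  rw [h0, Finset.card_eq_zero] at hcard
  have := hz i
  simpa [Constraint.CoveredBy, hcard] using this

theorem one_le_lpOpt (h : ∃ z, Feasible I z) (h0 : opt I ≠ 0) : 1 ≤ lpOpt I := by
  have hi : ∃ i, (I i).req ≠ 0 := by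
    by_contra! hall
    refine h0 (Nat.sInf_eq_zero.2 (Or.inl ⟨∅, fun i => ?_, rfl⟩))
    simp [Constraint.CoveredBy, hall i]
  obtain ⟨i, hi⟩ := hi
  obtain ⟨x, hx, hsum⟩ := exists_lpFeasible_sum_eq_lpOpt h
  rw [← hsum]
  have h1 : (1 : ℝ) ≤ (I i).req := by exact_mod_cast Nat.one_le_iff_ne_zero.2 hi
  exact h1.trans ((hx.2 i).trans
    (Finset.sum_le_sum_of_subset_of_nonneg (Finset.subset_univ _) fun j _ _ => (hx.1 j).1))

theorem lpValue_le_lpOpt (h : ∃ z, Feasible I z) {cs : List (Constraint m)}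
    (hcs : ∀ c ∈ cs, ∃ i, c = I i) : lpValue cs ≤ lpOpt I := by
  obtain ⟨x, hx, hsum⟩ := exists_lpFeasible_sum_eq_lpOpt h
  exact csInf_le (bddBelow_fracCover cs) ⟨x, hx.fracCover hcs, hsum⟩

theorem le_lpValue (h : ∃ z, Feasible I z) {cs : List (Constraint m)}
    (hcs : ∀ c ∈ cs, ∃ i, c = I i) {b : ℝ} (hb : ∀ x, FracCover cs x → b ≤ ∑ j, x j) :
    b ≤ lpValue cs := by
  obtain ⟨z, hz⟩ := h
  refine le_csInf ⟨_, _, hz.lpFeasible.fracCover hcs, rfl⟩ ?_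
  rintro _ ⟨x, hx, rfl⟩
  exact hb x hx

end LinearProgram

/-! ### The multiplicative update and the learning potential. -/

section Learning

variable {m : ℕ}

/-- The divergence, up to a constant, of the fractional solution `x` of total weight `β` from the
reference solution `u`. -/
noncomputable def divergence (β : ℝ) (u x : Fin m → ℝ) : ℝ :=
  ∑ j, u j * Real.log (β / x j)

theorem sum_mul_exp_indicator (T : Finset (Fin m)) (x : Fin m → ℝ) :
    ∑ j, x j * Real.exp (if j ∈ T then 1 else 0) =
      ∑ j, x j + (Real.exp 1 - 1) * ∑ j ∈ T, x j := by
  have h : (Real.exp 1 - 1) * ∑ j ∈ T, x j =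
      ∑ j, if j ∈ T then (Real.exp 1 - 1) * x j else 0 := by
    rw [Finset.sum_ite_mem, Finset.univ_inter, Finset.mul_sum]
  rw [h, ← Finset.sum_add_distrib]
  refine Finset.sum_congr rfl fun j _ => ?_
  by_cases hj : j ∈ T
  · simp only [hj, if_true]
    ring
  · simp [hj]

theorem exp_one_sub_one_pos : 0 < Real.exp 1 - 1 := by
  have := Real.add_one_lt_exp (one_ne_zero (α := ℝ))
  linarith

/-- The normalizing factor of the multiplicative update. -/
theorem normalizer_eq {β : ℝ} (hβ : 0 < β) (T : Finset (Fin m)) {x : Fin m → ℝ}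
    (hsum : ∑ j, x j = β) :
    (∑ j, x j * Real.exp (if j ∈ T then 1 else 0)) / β =
      1 + (Real.exp 1 - 1) * (∑ j ∈ T, x j) / β := by
  rw [sum_mul_exp_indicator, hsum, add_div, div_self hβ.ne']

theorem one_le_normalizer {β : ℝ} (hβ : 0 < β) (T : Finset (Fin m)) {x : Fin m → ℝ}
    (hx : ∀ j, 0 < x j) (hsum : ∑ j, x j = β) :
    1 ≤ (∑ j, x j * Real.exp (if j ∈ T then 1 else 0)) / β := by
  rw [normalizer_eq hβ T hsum, le_add_iff_nonneg_right]
  have := exp_one_sub_one_pos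
  have := Finset.sum_nonneg fun j (_ : j ∈ T) => (hx j).le
  positivity

theorem reweight_pos {β : ℝ} (hβ : 0 < β) (T : Finset (Fin m)) {x : Fin m → ℝ}
    (hx : ∀ j, 0 < x j) (hsum : ∑ j, x j = β) (j : Fin m) : 0 < reweight β T x j :=
  div_pos (mul_pos (hx j) (Real.exp_pos _))
    (zero_lt_one.trans_le (one_le_normalizer hβ T hx hsum))

theorem reweight_le {β : ℝ} (hβ : 0 < β) (T : Finset (Fin m)) {x : Fin m → ℝ}
    (hx : ∀ j, 0 < x j) (hsum : ∑ j, x j = β) (j : Fin m) :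
    reweight β T x j ≤ x j * Real.exp (if j ∈ T then 1 else 0) :=
  div_le_self (mul_pos (hx j) (Real.exp_pos _)).le (one_le_normalizer hβ T hx hsum)

theorem sum_reweight {β : ℝ} (hβ : 0 < β) (T : Finset (Fin m)) {x : Fin m → ℝ}
    (hx : ∀ j, 0 < x j) (hsum : ∑ j, x j = β) : ∑ j, reweight β T x j = β := by
  have h := one_le_normalizer hβ T hx hsum
  have h0 : ∑ j, x j * Real.exp (if j ∈ T then 1 else 0) ≠ 0 := by
    intro h0
    rw [h0, zero_div] at h
    linarith
  unfold reweight
  dsimp only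
  rw [← Finset.sum_div]
  field_simp

/-- Multiplying by `e` on `T` gains `u j` for each `j ∈ T`. Dividing by the normalizer `Z` loses `(∑
u) log Z`, where `∑ u ≤ β` and `log Z ≤ Z - 1 = (e - 1) ∑_T x / β`; the factor 2 bounds `e - 1`. -/
theorem divergence_reweight_le {β : ℝ} (hβ : 0 < β) (T : Finset (Fin m)) {x u : Fin m → ℝ}
    (hx : ∀ j, 0 < x j) (hsum : ∑ j, x j = β) (hu : ∑ j, u j ≤ β) :
    divergence β u (reweight β T x) ≤
      divergence β u x - ∑ j ∈ T, u j + 2 * ∑ j ∈ T, x j := by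
  set Z : ℝ := (∑ j, x j * Real.exp (if j ∈ T then 1 else 0)) / β with hZ
  have hZ1 : 1 ≤ Z := one_le_normalizer hβ T hx hsum
  have hX : 0 ≤ ∑ j ∈ T, x j := Finset.sum_nonneg fun j _ => (hx j).le
  have hlogZ : Real.log Z ≤ 2 * (∑ j ∈ T, x j) / β := by
    refine (Real.log_le_sub_one_of_pos (by linarith)).trans ?_
    rw [hZ, normalizer_eq hβ T hsum, add_sub_cancel_left]
    have := Real.exp_one_lt_d9
    gcongr
    linarith
  have hterm (j : Fin m) : u j * Real.log (β / reweight β T x j) =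
      u j * Real.log (β / x j) + u j * Real.log Z - if j ∈ T then u j else 0 := by
    have h1 : β / reweight β T x j =
        β / x j * Z / Real.exp (if j ∈ T then 1 else 0) := by
      change β / (x j * Real.exp (if j ∈ T then 1 else 0) / Z) = _
      have := (hx j).ne'
      have := (zero_lt_one.trans_le hZ1).ne'
      have := (Real.exp_pos (if j ∈ T then 1 else 0)).ne'
      field_simp
    rw [h1, Real.log_div (mul_pos (div_pos hβ (hx j)) (by linarith)).ne' (Real.exp_pos _).ne',
      Real.log_mul (div_pos hβ (hx j)).ne' (by linarith), Real.log_exp]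
    split_ifs <;> ring
  have hsumeq : divergence β u (reweight β T x) =
      divergence β u x + (∑ j, u j) * Real.log Z - ∑ j ∈ T, u j := by
    unfold divergence
    simp_rw [hterm, Finset.sum_sub_distrib, Finset.sum_add_distrib, ← Finset.sum_mul]
    simp
  have hbound : (∑ j, u j) * Real.log Z ≤ 2 * ∑ j ∈ T, x j := by
    calc (∑ j, u j) * Real.log Z ≤ β * (2 * (∑ j ∈ T, x j) / β) :=
          mul_le_mul hu hlogZ (Real.log_nonneg hZ1) hβ.le
      _ = _ := by field_simp
  linarith

theorem divergence_nonneg {β : ℝ} {x u : Fin m → ℝ} (hx : ∀ j, 0 < x j)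
    (hsum : ∑ j, x j = β) (hu0 : ∀ j, 0 ≤ u j) : 0 ≤ divergence β u x := by
  refine Finset.sum_nonneg fun j _ => mul_nonneg (hu0 j) (Real.log_nonneg ?_)
  rw [one_le_div (hx j), ← hsum]
  exact Finset.single_le_sum (fun k _ => (hx k).le) (Finset.mem_univ j)

/-- The largest divergence from a fractional cover of weight at most `β`. -/
noncomputable def learnPotential (β : ℝ) (cs : List (Constraint m)) (x : Fin m → ℝ) : ℝ :=
  sSup ((fun u => divergence β u x) '' coversWithin β cs)

theorem learnPotential_nonneg {β : ℝ} (cs : List (Constraint m)) {x : Fin m → ℝ}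
    (hx : ∀ j, 0 < x j) (hsum : ∑ j, x j = β) : 0 ≤ learnPotential β cs x := by
  -- If there is no cover, the supremum is 0 by convention, so nonemptiness is not needed.
  refine Real.sSup_nonneg ?_
  rintro _ ⟨u, hu, rfl⟩
  exact divergence_nonneg hx hsum fun j => (hu.1.1 j).1

theorem divergence_le_learnPotential {β : ℝ} {cs : List (Constraint m)} {x u : Fin m → ℝ}
    (hx : ∀ j, 0 < x j) (hsum : ∑ j, x j = β) (hu : u ∈ coversWithin β cs) :
    divergence β u x ≤ learnPotential β cs x := by
  -- Boundedness comes from `u j ≤ 1` and `x j ≤ β`.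
  refine le_csSup ⟨∑ j, Real.log (β / x j), ?_⟩ ⟨u, hu, rfl⟩
  rintro _ ⟨v, hv, rfl⟩
  refine Finset.sum_le_sum fun j _ => mul_le_of_le_one_left (Real.log_nonneg ?_) (hv.1.1 j).2
  rw [one_le_div (hx j), ← hsum]
  exact Finset.single_le_sum (fun k _ => (hx k).le) (Finset.mem_univ j)

theorem learnPotential_uniform_le {β : ℝ} (hm : 0 < m) (hβ : 0 < β)
    (cs : List (Constraint m)) :
    learnPotential β cs (fun _ => β / m) ≤ β * Real.log m := by
  have hlog : 0 ≤ Real.log m := Real.log_nonneg (by exact_mod_cast hm)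
  refine Real.sSup_le ?_ (mul_nonneg hβ.le hlog)
  rintro _ ⟨u, hu, rfl⟩
  have h : β / (β / m) = m := by field_simp
  simp only [divergence, h, ← Finset.sum_mul]
  exact mul_le_mul_of_nonneg_right hu.2 hlog

/-- A new constraint only shrinks the set over which the supremum is taken, so a decrease common to
all remaining covers passes to the supremum. -/
theorem learnPotential_cons_le {β : ℝ} {c : Constraint m} {cs : List (Constraint m)}
    {x x' : Fin m → ℝ} {δ : ℝ} (hx : ∀ j, 0 < x j) (hsum : ∑ j, x j = β)
    (hne : (coversWithin β (c :: cs)).Nonempty)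
    (h : ∀ u ∈ coversWithin β (c :: cs), divergence β u x' ≤ divergence β u x + δ) :
    learnPotential β (c :: cs) x' ≤ learnPotential β cs x + δ := by
  refine csSup_le (hne.image _) ?_
  rintro _ ⟨u, hu, rfl⟩
  exact (h u hu).trans
    (add_le_add_left (divergence_le_learnPotential hx hsum ⟨hu.1.tail, hu.2⟩) δ)

end Learning

/-! ### Monotonicity and coverage. -/

section Validity

variable {m : ℕ}

theorem OnlineAlg.valid_of_step (alg : OnlineAlg m)
    (hsub : ∀ s c, ∀ s' ∈ (alg.step s c).support, alg.sol s ⊆ alg.sol s')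
    (hcov : ∀ s c, c.req ≤ c.supp.card → ∀ s' ∈ (alg.step s c).support,
      c.CoveredBy (alg.sol s')) : alg.Valid := by
  have hrun (cs : List (Constraint m)) : ∀ s, ∀ s' ∈ (alg.runFrom s cs).support,
      alg.sol s ⊆ alg.sol s' := by
    induction cs with
    | nil =>
      intro s s' hs'
      rw [runFrom, PMF.support_pure, Set.mem_singleton_iff] at hs'
      rw [hs']
    | cons c cs ih =>
      intro s s' hs'
      rw [runFrom, PMF.mem_support_bind_iff] at hs'
      obtain ⟨t, ht, hs'⟩ := hs'
      exact (hsub s c t ht).trans (ih t s' hs')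
  have hruncov (cs : List (Constraint m)) : (∀ c ∈ cs, c.req ≤ c.supp.card) →
      ∀ s, ∀ s' ∈ (alg.runFrom s cs).support, ∀ c ∈ cs, c.CoveredBy (alg.sol s') := by
    induction cs with
    | nil => simp
    | cons c cs ih =>
      intro hreq s s' hs' c' hc'
      rw [runFrom, PMF.mem_support_bind_iff] at hs'
      obtain ⟨t, ht, hs'⟩ := hs'
      rcases List.mem_cons.1 hc' with rfl | hc'
      · exact (hcov s c' (hreq _ List.mem_cons_self) t ht).trans
          (Finset.card_le_card (Finset.inter_subset_inter_left (hrun cs t s' hs')))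
      · exact ih (fun c hc => hreq c (List.mem_cons_of_mem _ hc)) t s' hs' c' hc'
  exact ⟨fun cs c s _ s' hs' => hsub s c s' hs', fun cs hreq => hruncov cs hreq _⟩

theorem coveredBy_union_backup {backup : BackupRule m} (hb : backup.Admissible)
    {c : Constraint m} (hc : c.req ≤ c.supp.card) {z z' : Finset (Fin m)} (hz : z ⊆ z')
    (h : List (Constraint m × Finset (Fin m))) :
    c.CoveredBy (z' ∪ backup h (c.supp \ z) (undercoverage c z)) := by
  obtain ⟨h1, h2⟩ := hb h _ _ (undercoverage_le_card hc z)
  have h3 : (c.supp \ z) ∩ backup h (c.supp \ z) (undercoverage c z) =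
      backup h (c.supp \ z) (undercoverage c z) := Finset.inter_eq_right.2 h1
  have h4 : undercoverage c (z ∪ backup h (c.supp \ z) (undercoverage c z)) = 0 := by
    rw [undercoverage_union, h3, h2, min_self, Nat.sub_self]
  rw [coveredBy_iff, ← Nat.le_zero, ← h4]
  exact undercoverage_anti c (Finset.union_subset_union_left hz)

end Validity

/-! ### One round: cost, learning and covering. -/

section Step

variable {m : ℕ} {β : ℝ} {backup : BackupRule m}

open Classical in
/-- The integer solution after the first two steps of a round, before any backup columns. -/
noncomputable def sampledSol (s : LOCState m) (c : Constraint m) (R : Finset (Fin m)) :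
    Finset (Fin m) :=
  if openWeight c s.z s.x ≤ (undercoverage c s.z : ℝ) then
    s.z ∪ R ∪ (c.supp \ s.z).filter (fun j => 1 / Real.exp 1 ≤ s.x j) else s.z ∪ R

open Classical in
/-- The outcome of a round of LearnOrCoverSMC in which the arriving constraint is not yet
covered and the columns `R` are sampled. -/
noncomputable def locNext (β : ℝ) (backup : BackupRule m) (s : LOCState m) (c : Constraint m)
    (R : Finset (Fin m)) : LOCState m where
  x := if openWeight c s.z s.x ≤ (undercoverage c s.z : ℝ) then
    reweight β (c.supp \ s.z) s.x else s.x
  z := if c.CoveredBy (sampledSol s c R) then sampledSol s c R else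
    sampledSol s c R ∪ backup ((c, R) :: s.hist) (c.supp \ s.z) (undercoverage c s.z)
  hist := (c, R) :: s.hist

theorem locStep_of_coveredBy {s : LOCState m} {c : Constraint m} (h : c.CoveredBy s.z) :
    locStep β backup s c = PMF.pure { s with hist := (c, ∅) :: s.hist } := by
  rw [locStep, if_pos h]

theorem locStep_of_not_coveredBy {s : LOCState m} {c : Constraint m} (h : ¬ c.CoveredBy s.z) :
    locStep β backup s c =
      (sampleSet fun j => ENNReal.ofReal ((undercoverage c s.z : ℝ) * s.x j / β)).map
        (locNext β backup s c) := by
  rw [locStep, if_neg h]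
  rfl

theorem subset_sampledSol (s : LOCState m) (c : Constraint m) (R : Finset (Fin m)) :
    s.z ∪ R ⊆ sampledSol s c R := by
  unfold sampledSol
  split_ifs
  · exact Finset.subset_union_left
  · exact Finset.Subset.refl _

theorem sampledSol_subset (s : LOCState m) (c : Constraint m) (R : Finset (Fin m)) :
    sampledSol s c R ⊆ (locNext β backup s c R).z := by
  unfold locNext
  dsimp only
  split_ifs
  · exact Finset.Subset.refl _
  · exact Finset.subset_union_left

theorem subset_locNext_z (s : LOCState m) (c : Constraint m) (R : Finset (Fin m)) :
    s.z ∪ R ⊆ (locNext β backup s c R).z :=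
  (subset_sampledSol s c R).trans (sampledSol_subset s c R)

theorem mem_locNext_z_of_le {s : LOCState m} {c : Constraint m} (R : Finset (Fin m))
    (hX : openWeight c s.z s.x ≤ (undercoverage c s.z : ℝ)) {j : Fin m}
    (hj : j ∈ c.supp \ s.z) (hxj : 1 / Real.exp 1 ≤ s.x j) :
    j ∈ (locNext β backup s c R).z := by
  refine sampledSol_subset s c R ?_
  rw [sampledSol, if_pos hX]
  exact Finset.mem_union_right _ (Finset.mem_filter.2 ⟨hj, hxj⟩)

theorem coveredBy_locNext_z (hb : backup.Admissible) (s : LOCState m) {c : Constraint m}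
    (hc : c.req ≤ c.supp.card) (R : Finset (Fin m)) :
    c.CoveredBy (locNext β backup s c R).z := by
  unfold locNext
  dsimp only
  split_ifs with h
  · exact h
  · exact coveredBy_union_backup hb hc
      (Finset.subset_union_left.trans (subset_sampledSol s c R)) _

theorem subset_of_mem_support_locStep {s s' : LOCState m} {c : Constraint m}
    (h : s' ∈ (locStep β backup s c).support) : s.z ⊆ s'.z := by
  by_cases hc : c.CoveredBy s.z
  · rw [locStep_of_coveredBy hc, PMF.support_pure, Set.mem_singleton_iff] at h
    rw [h]
  · rw [locStep_of_not_coveredBy hc, PMF.support_map] at h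
    obtain ⟨R, -, rfl⟩ := h
    exact Finset.subset_union_left.trans (subset_locNext_z s c R)

theorem coveredBy_of_mem_support_locStep (hb : backup.Admissible) {s s' : LOCState m}
    {c : Constraint m} (hreq : c.req ≤ c.supp.card)
    (h : s' ∈ (locStep β backup s c).support) : c.CoveredBy s'.z := by
  by_cases hc : c.CoveredBy s.z
  · rw [locStep_of_coveredBy hc, PMF.support_pure, Set.mem_singleton_iff] at h
    rw [h]
    exact hc
  · rw [locStep_of_not_coveredBy hc, PMF.support_map] at h
    obtain ⟨R, -, rfl⟩ := h
    exact coveredBy_locNext_z hb s hreq R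

/-- The fractional solution is positive, has total weight `β`, and does not exceed two on the
columns that have not been bought. -/
structure Regular (β : ℝ) (s : LOCState m) : Prop where
  pos : ∀ j, 0 < s.x j
  sum_eq : ∑ j, s.x j = β
  le_two : ∀ j, j ∉ s.z → s.x j ≤ 2

/-- The constraints that have arrived. -/
def LOCState.seen (s : LOCState m) : List (Constraint m) := s.hist.map Prod.fst

theorem Regular.locNext {s : LOCState m} (h : Regular β s) (hβ : 0 < β) (c : Constraint m)
    (R : Finset (Fin m)) : Regular β (locNext β backup s c R) := by
  by_cases hX : openWeight c s.z s.x ≤ (undercoverage c s.z : ℝ)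
  · have hx : (SetMulticover.locNext β backup s c R).x = reweight β (c.supp \ s.z) s.x :=
      if_pos hX
    refine ⟨fun j => ?_, ?_, fun j hj => ?_⟩
    · rw [hx]
      exact reweight_pos hβ _ h.pos h.sum_eq j
    · rw [hx]
      exact sum_reweight hβ _ h.pos h.sum_eq
    · rw [hx]
      refine (reweight_le hβ _ h.pos h.sum_eq j).trans ?_
      by_cases hjT : j ∈ c.supp \ s.z
      · rw [if_pos hjT]
        -- A column of `T` still unbought had `x j < 1 / e`, or step 2 would have bought it; after
        -- the update it is at most 1. The bound two is needed only for the initial value `β / m`.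
        have hlt : s.x j < 1 / Real.exp 1 := by
          by_contra! hge
          exact hj (mem_locNext_z_of_le R hX hjT hge)
        rw [lt_div_iff₀ (Real.exp_pos 1)] at hlt
        linarith
      · rw [if_neg hjT, Real.exp_zero, mul_one]
        exact h.le_two j fun hjz => hj (subset_locNext_z s c R (Finset.mem_union_left _ hjz))
  · have hx : (SetMulticover.locNext β backup s c R).x = s.x := if_neg hX
    refine ⟨fun j => hx ▸ h.pos j, hx ▸ h.sum_eq, fun j hj => ?_⟩
    rw [hx]
    exact h.le_two j fun hjz => hj (subset_locNext_z s c R (Finset.mem_union_left _ hjz))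

theorem Regular.of_mem_support_locStep {s s' : LOCState m} (h : Regular β s) (hβ : 0 < β)
    {c : Constraint m} (hs' : s' ∈ (locStep β backup s c).support) :
    Regular β s' ∧ s'.seen = c :: s.seen := by
  by_cases hc : c.CoveredBy s.z
  · rw [locStep_of_coveredBy hc, PMF.support_pure, Set.mem_singleton_iff] at hs'
    rw [hs']
    exact ⟨⟨h.pos, h.sum_eq, h.le_two⟩, rfl⟩
  · rw [locStep_of_not_coveredBy hc, PMF.support_map] at hs'
    obtain ⟨R, -, rfl⟩ := hs'
    exact ⟨h.locNext hβ c R, rfl⟩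

/-- In an undercovered round the open columns with `x j ≥ 1 / e` have total weight at most `d`, so
there are at most `e d ≤ 3 d` of them; the backup adds at most `d` more. -/
theorem card_locNext_z_le (hb : backup.Admissible) {s : LOCState m} (hx : ∀ j, 0 < s.x j)
    {c : Constraint m} (hc : c.req ≤ c.supp.card) (R : Finset (Fin m)) :
    ((locNext β backup s c R).z.card : ℝ) ≤ s.z.card + R.card + 4 * undercoverage c s.z := by
  classical
  set d := undercoverage c s.z with hd
  have hbackup : (backup ((c, R) :: s.hist) (c.supp \ s.z) d).card = d :=
    (hb _ _ _ (undercoverage_le_card hc s.z)).2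
  have hfilter (hX : openWeight c s.z s.x ≤ (d : ℝ)) :
      (((c.supp \ s.z).filter (fun j => 1 / Real.exp 1 ≤ s.x j)).card : ℝ) ≤ 3 * d := by
    set A := (c.supp \ s.z).filter (fun j => 1 / Real.exp 1 ≤ s.x j) with hA
    have h1 : (A.card : ℝ) * (1 / Real.exp 1) ≤ ∑ j ∈ A, s.x j := by
      simpa using Finset.card_nsmul_le_sum A s.x (1 / Real.exp 1)
        fun j hj => (Finset.mem_filter.1 hj).2
    have h2 : ∑ j ∈ A, s.x j ≤ openWeight c s.z s.x :=
      Finset.sum_le_sum_of_subset_of_nonneg (Finset.filter_subset _ _) fun j _ _ => (hx j).le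
    have h3 : (A.card : ℝ) ≤ d * Real.exp 1 := by
      rw [mul_one_div] at h1
      exact (div_le_iff₀ (Real.exp_pos 1)).1 (h1.trans (h2.trans hX))
    have h4 := Real.exp_one_lt_d9
    have h5 : (0 : ℝ) ≤ d := Nat.cast_nonneg d
    nlinarith
  have hunion (A B : Finset (Fin m)) : ((A ∪ B).card : ℝ) ≤ A.card + B.card := by
    exact_mod_cast Finset.card_union_le A B
  have hd0 : (0 : ℝ) ≤ d := Nat.cast_nonneg d
  have hz₁ : ((sampledSol s c R).card : ℝ) ≤ s.z.card + R.card + 3 * d := by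
    have hzR := hunion s.z R
    unfold sampledSol
    split_ifs with hX
    · refine (hunion _ _).trans (add_le_add hzR ?_)
      convert hfilter hX
    · linarith
  unfold locNext
  dsimp only
  split_ifs
  · linarith
  · have := hunion (sampledSol s c R) (backup ((c, R) :: s.hist) (c.supp \ s.z) d)
    rw [hbackup] at this
    linarith

/-- The minimum unites two cases. If `X ≤ d` the update gains `d` and loses at most `2 X`. If `X >
d` nothing is updated and the allowance `-d + 2 d` is nonnegative. -/
theorem learnPotential_locNext_le {s : LOCState m} (h : Regular β s) (hβ : 0 < β)
    {c : Constraint m} (hc : (coversWithin β (c :: s.seen)).Nonempty) (R : Finset (Fin m)) :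
    learnPotential β (c :: s.seen) (locNext β backup s c R).x ≤
      learnPotential β s.seen s.x + (-undercoverage c s.z +
        2 * min (undercoverage c s.z : ℝ) (openWeight c s.z s.x)) := by
  refine learnPotential_cons_le h.pos h.sum_eq hc fun u hu => ?_
  have hcover := hu.1.undercoverage_le List.mem_cons_self s.z
  have hd0 : (0 : ℝ) ≤ undercoverage c s.z := Nat.cast_nonneg _
  by_cases hX : openWeight c s.z s.x ≤ (undercoverage c s.z : ℝ)
  · have hx : (locNext β backup s c R).x = reweight β (c.supp \ s.z) s.x := if_pos hX
    have := divergence_reweight_le hβ (c.supp \ s.z) h.pos h.sum_eq hu.2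
    rw [hx, min_eq_right hX]
    unfold openWeight
    linarith
  · have hx : (locNext β backup s c R).x = s.x := if_neg hX
    rw [hx, min_eq_left (not_le.1 hX).le]
    linarith

theorem undercoverage_locNext_le (s : LOCState m) (c c' : Constraint m) (R : Finset (Fin m)) :
    (undercoverage c' (locNext β backup s c R).z : ℝ) ≤ undercoverage c' s.z -
      min (undercoverage c' s.z : ℝ) (((c'.supp \ s.z) ∩ R).card : ℝ) := by
  rw [← Nat.cast_min, ← Nat.cast_sub (min_le_left _ _), ← undercoverage_union]
  exact_mod_cast undercoverage_anti c' (subset_locNext_z s c R)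

/-- Sampling with intensity `d` reduces the undercoverage of every other constraint. -/
theorem Regular.le_sum_sampleWeight_min {s : LOCState m} (h : Regular β s) (hβ : 0 < β) {d : ℝ}
    (hd0 : 0 ≤ d) (hd : d ≤ β) (c : Constraint m) :
    d / (4 * β) * min (undercoverage c s.z : ℝ) (openWeight c s.z s.x) ≤
      ∑ R, sampleWeight (fun j => min 1 (d * s.x j / β)) R *
        min (undercoverage c s.z : ℝ) (((c.supp \ s.z) ∩ R).card : ℝ) := by
  have hy0 (j) : 0 ≤ d * s.x j / β := by
    have := (h.pos j).le
    positivity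
  refine le_trans ?_ (half_min_le_sum_sampleWeight (fun j => le_min zero_le_one (hy0 j))
    (fun j => min_le_left _ _) (c.supp \ s.z) (undercoverage c s.z))
  have hmean : d / (2 * β) * openWeight c s.z s.x ≤
      ∑ j ∈ c.supp \ s.z, min 1 (d * s.x j / β) := by
    unfold openWeight
    rw [Finset.mul_sum]
    refine Finset.sum_le_sum fun j hj => le_min ?_ ?_
    -- As `d ≤ β` and `x j ≤ 2` on unbought columns, half the nominal rate is at most 1, so capping
    -- probabilities at 1 costs only a factor of two.
    · rw [div_mul_eq_mul_div, div_le_one (by positivity)]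
      have h2 := h.le_two j (Finset.mem_sdiff.1 hj).2
      have h0 := (h.pos j).le
      nlinarith
    · have h1 : d / (2 * β) * s.x j = d * s.x j / β / 2 := by
        field_simp
      rw [h1]
      linarith [hy0 j]
  have hX0 : 0 ≤ openWeight c s.z s.x := openWeight_nonneg c s.z fun j => (h.pos j).le
  have hmin0 : 0 ≤ min (undercoverage c s.z : ℝ) (openWeight c s.z s.x) :=
    le_min (Nat.cast_nonneg _) hX0
  have hfac0 : 0 ≤ d / (2 * β) := by positivity
  have hfac1 : d / (2 * β) ≤ 1 := by
    rw [div_le_one (by positivity)]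
    linarith
  have hkey : d / (2 * β) * min (undercoverage c s.z : ℝ) (openWeight c s.z s.x) ≤
      min (undercoverage c s.z : ℝ) (∑ j ∈ c.supp \ s.z, min 1 (d * s.x j / β)) := by
    refine le_min ?_ ?_
    · exact (mul_le_of_le_one_left hmin0 hfac1).trans (min_le_left _ _)
    · exact (mul_le_mul_of_nonneg_left (min_le_right _ _) hfac0).trans hmean
  have h4 : d / (4 * β) = d / (2 * β) / 2 := by
    field_simp
    norm_num
  rw [h4]
  linarith

end Step

/-! ### The potential and its drift. -/

section Potential

variable {m n : ℕ} {I : Instance m n} {β : ℝ} {backup : BackupRule m}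

open Classical in
/-- The rows in `U` that can be added to the constraints seen so far without pushing the value of
the linear program above `β`. -/
noncomputable def goodRows (I : Instance m n) (β : ℝ) (s : LOCState m) (U : Finset (Fin n)) :
    Finset (Fin n) :=
  U.filter fun i => (coversWithin β (I i :: s.seen)).Nonempty

theorem mem_goodRows {s : LOCState m} {U : Finset (Fin n)} {i : Fin n} :
    i ∈ goodRows I β s U ↔ i ∈ U ∧ (coversWithin β (I i :: s.seen)).Nonempty := by
  classical exact Finset.mem_filter

/-- The total undercoverage of the good rows. -/
noncomputable def residual (I : Instance m n) (β : ℝ) (s : LOCState m) (U : Finset (Fin n)) : ℝ :=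
  ∑ i ∈ goodRows I β s U, (undercoverage (I i) s.z : ℝ)

theorem residual_nonneg (s : LOCState m) (U : Finset (Fin n)) : 0 ≤ residual I β s U :=
  Finset.sum_nonneg fun _ _ => Nat.cast_nonneg _

theorem coversWithin_cons_cons_subset (c c' : Constraint m) (cs : List (Constraint m)) :
    coversWithin β (c' :: c :: cs) ⊆ coversWithin β (c' :: cs) := fun _ hx =>
  ⟨⟨hx.1.1, fun a ha => hx.1.2 a (by
    rcases List.mem_cons.1 ha with rfl | ha
    · exact List.mem_cons_self
    · exact List.mem_cons_of_mem _ (List.mem_cons_of_mem _ ha))⟩, hx.2⟩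

/-- Seeing more constraints can only turn good rows bad, and a row that leaves the sum removes a
nonnegative term. -/
theorem residual_le_sub {s s' : LOCState m} {c : Constraint m} (hseen : s'.seen = c :: s.seen)
    {U U' : Finset (Fin n)} (hU : U' ⊆ U) (r : Fin n → ℝ)
    (h : ∀ i, (undercoverage (I i) s'.z : ℝ) ≤ undercoverage (I i) s.z - r i) :
    residual I β s' U' ≤ residual I β s U - ∑ i ∈ goodRows I β s U, r i := by
  unfold residual
  rw [← Finset.sum_sub_distrib]
  refine (Finset.sum_le_sum fun i _ => h i).trans
    (Finset.sum_le_sum_of_subset_of_nonneg (fun i hi => ?_) fun i _ _ =>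
      (Nat.cast_nonneg _).trans (h i))
  rw [mem_goodRows] at hi ⊢
  refine ⟨hU hi.1, ?_⟩
  rw [hseen] at hi
  exact hi.2.mono (coversWithin_cons_cons_subset _ _ _)

theorem residual_le (hI : ∃ z, Feasible I z) (s : LOCState m) (U : Finset (Fin n)) :
    residual I β s U ≤ m * n := by
  obtain ⟨z, hz⟩ := hI
  have h (i : Fin n) : (undercoverage (I i) s.z : ℝ) ≤ m := by
    have h1 : (I i).supp.card ≤ m := (Finset.card_le_univ _).trans_eq (Fintype.card_fin m)
    exact_mod_cast (Nat.sub_le _ _).trans ((hz.req_le i).trans h1)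
  calc residual I β s U ≤ (goodRows I β s U).card • (m : ℝ) :=
        Finset.sum_le_card_nsmul _ _ _ fun i _ => h i
    _ = m * ((goodRows I β s U).card : ℝ) := by rw [nsmul_eq_mul, mul_comm]
    _ ≤ m * n := by
        gcongr
        exact (Finset.card_le_univ _).trans_eq (Fintype.card_fin n)

/-- Concavity of the logarithm: the tangent at `1 + a` lies above the graph. -/
theorem log_one_add_le {a b δ : ℝ} (ha : 0 ≤ a) (hb : 0 ≤ b) (h : b ≤ a - δ) :
    Real.log (1 + b) ≤ Real.log (1 + a) - δ / (1 + a) := by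
  have h1 : Real.log ((1 + b) / (1 + a)) ≤ (1 + b) / (1 + a) - 1 :=
    Real.log_le_sub_one_of_pos (by positivity)
  rw [Real.log_div (by positivity) (by positivity)] at h1
  have h2 : (1 + b) / (1 + a) - 1 ≤ -(δ / (1 + a)) := by
    rw [div_sub_one (by positivity), ← neg_div]
    gcongr
    linarith
  linarith

/-- The potential: the cost so far, the learning and covering potentials of the current estimate
`β`, and a reserve for future estimates. -/
noncomputable def potential (I : Instance m n) (β : ℝ) (s : LOCState m) (U : Finset (Fin n)) : ℝ :=
  s.z.card + 5 * learnPotential β s.seen s.x + 80 * β * Real.log (1 + residual I β s U) +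
    86 * Real.log (1 + m * n) * (4 * lpOpt I - 2 * β)

/-- The invariant of a run with the current estimate `β`. -/
structure Consistent (I : Instance m n) (β : ℝ) (s : LOCState m) : Prop where
  pos : 0 < β
  le_lpOpt : β ≤ 2 * lpOpt I
  regular : Regular β s
  seen : ∀ c ∈ s.seen, ∃ i, c = I i

theorem log_one_add_nonneg (m n : ℕ) : 0 ≤ Real.log (1 + m * n) :=
  Real.log_nonneg (by
    have : (0 : ℝ) ≤ m * n := by positivity
    linarith)

theorem Consistent.card_le_potential {s : LOCState m} (h : Consistent I β s)
    (U : Finset (Fin n)) : (s.z.card : ℝ) ≤ potential I β s U := by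
  have h1 := learnPotential_nonneg s.seen h.regular.pos h.regular.sum_eq
  have h2 : 0 ≤ β * Real.log (1 + residual I β s U) :=
    mul_nonneg h.pos.le (Real.log_nonneg (by linarith [residual_nonneg (I := I) (β := β) s U]))
  have h3 : 0 ≤ Real.log (1 + m * n) * (4 * lpOpt I - 2 * β) :=
    mul_nonneg (log_one_add_nonneg m n) (by linarith [h.le_lpOpt])
  unfold potential
  nlinarith

theorem Consistent.potential_nonneg {s : LOCState m} (h : Consistent I β s)
    (U : Finset (Fin n)) : 0 ≤ potential I β s U :=
  (Nat.cast_nonneg _).trans (h.card_le_potential U)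

theorem Consistent.of_mem_support_locStep {s s' : LOCState m} (h : Consistent I β s) {i : Fin n}
    (hs' : s' ∈ (locStep β backup s (I i)).support) : Consistent I β s' := by
  obtain ⟨h1, h2⟩ := h.regular.of_mem_support_locStep h.pos hs'
  refine ⟨h.pos, h.le_lpOpt, h1, fun c hc => ?_⟩
  rw [h2] at hc
  rcases List.mem_cons.1 hc with rfl | hc
  · exact ⟨i, rfl⟩
  · exact h.seen c hc

/-- The truncated fractional weight of a row. -/
noncomputable def truncWeight (c : Constraint m) (s : LOCState m) : ℝ :=
  min (undercoverage c s.z : ℝ) (openWeight c s.z s.x)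

theorem Regular.truncWeight_nonneg {s : LOCState m} (h : Regular β s) (c : Constraint m) :
    0 ≤ truncWeight c s :=
  le_min (Nat.cast_nonneg _) (openWeight_nonneg _ _ fun j => (h.pos j).le)

/-- The bound on the expected potential after the good row `i` arrives. -/
noncomputable def goodBound (I : Instance m n) (β : ℝ) (s : LOCState m) (U : Finset (Fin n))
    (i : Fin n) : ℝ :=
  potential I β s U + 10 * truncWeight (I i) s -
    20 * undercoverage (I i) s.z * (∑ k ∈ goodRows I β s U, truncWeight (I k) s) /
      (1 + residual I β s U)

/-- For a fixed sample `R`: of the `-5 d` from learning, `-4 d` pays for the large and backup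
columns, and the remaining `-d` will cancel the expectation of `R.card`. -/
theorem potential_locNext_le (hb : backup.Admissible) (hI : ∃ z, Feasible I z) {s : LOCState m}
    (h : Consistent I β s) {U : Finset (Fin n)} {i : Fin n} (hi : i ∈ goodRows I β s U)
    (R : Finset (Fin m)) :
    potential I β (locNext β backup s (I i) R) (U.erase i) ≤
      (potential I β s U - undercoverage (I i) s.z + 10 * truncWeight (I i) s) + R.card -
        80 * β / (1 + residual I β s U) * ∑ k ∈ goodRows I β s U,
          min (undercoverage (I k) s.z : ℝ) ((((I k).supp \ s.z) ∩ R).card : ℝ) := by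
  classical
  obtain ⟨z, hz⟩ := hI
  have hgood := (mem_goodRows.1 hi).2
  have hcard := card_locNext_z_le (β := β) hb h.regular.pos (hz.req_le i) R
  have hlearn := learnPotential_locNext_le (backup := backup) h.regular h.pos hgood R
  have hseen : (locNext β backup s (I i) R).seen = I i :: s.seen := rfl
  have hres := residual_le_sub (I := I) (β := β) hseen (U.erase_subset i) _
    fun k => undercoverage_locNext_le s (I i) (I k) R
  have hlog := log_one_add_le (residual_nonneg s U) (residual_nonneg _ _) hres
  set A := ∑ k ∈ goodRows I β s U,
    min (undercoverage (I k) s.z : ℝ) ((((I k).supp \ s.z) ∩ R).card : ℝ)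
  have hcov := mul_le_mul_of_nonneg_left hlog (mul_nonneg (by norm_num : (0 : ℝ) ≤ 80) h.pos.le)
  have heq : 80 * β / (1 + residual I β s U) * A = 80 * β * (A / (1 + residual I β s U)) := by
    ring
  rw [← hseen] at hlearn
  rw [heq]
  unfold potential truncWeight
  linarith

theorem expect_locStep_potential_le (hb : backup.Admissible) (hI : ∃ z, Feasible I z)
    {s : LOCState m} (h : Consistent I β s) {U : Finset (Fin n)} {i : Fin n}
    (hi : i ∈ goodRows I β s U) :
    0 ≤ goodBound I β s U i ∧
      expect (locStep β backup s (I i))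
        (fun s' => ENNReal.ofReal (potential I β s' (U.erase i))) ≤
          ENNReal.ofReal (goodBound I β s U i) := by
  classical
  have hgood := (mem_goodRows.1 hi).2
  have hβ := h.pos
  by_cases hc : (I i).CoveredBy s.z
  · have hd := coveredBy_iff.1 hc
    have hbound : goodBound I β s U i = potential I β s U := by
      have : truncWeight (I i) s = 0 := by
        rw [truncWeight, hd, Nat.cast_zero]
        exact min_eq_left (openWeight_nonneg _ _ fun j => (h.regular.pos j).le)
      rw [goodBound, hd, this]
      simp
    rw [hbound]
    refine ⟨h.potential_nonneg U, ?_⟩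
    rw [locStep_of_coveredBy hc, expect_pure]
    refine ENNReal.ofReal_le_ofReal ?_
    set s' : LOCState m := { s with hist := (I i, ∅) :: s.hist } with hs'
    have hseen : s'.seen = I i :: s.seen := rfl
    have hlearn : learnPotential β s'.seen s'.x ≤ learnPotential β s.seen s.x + 0 :=
      learnPotential_cons_le h.regular.pos h.regular.sum_eq hgood fun u _ => (add_zero _).ge
    have hres := residual_le_sub (I := I) (β := β) hseen (U.erase_subset i) (fun _ => 0)
      fun k => (sub_zero _).ge
    have hlog := log_one_add_le (residual_nonneg s U) (residual_nonneg _ _) hres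
    have hcov := mul_le_mul_of_nonneg_left hlog (mul_nonneg (by norm_num : (0 : ℝ) ≤ 80) hβ.le)
    simp only [Finset.sum_const_zero, zero_div, sub_zero] at hcov
    unfold potential
    change (s.z.card : ℝ) + _ + _ + _ ≤ _
    linarith
  · set d : ℝ := ((undercoverage (I i) s.z : ℕ) : ℝ) with hd
    have hd0 : 0 ≤ d := Nat.cast_nonneg _
    -- A good row has a cover of weight at most `β`, which must supply the deficit `d`.
    have hdβ : d ≤ β := by
      obtain ⟨u, hu⟩ := hgood
      exact (hu.1.undercoverage_le_sum List.mem_cons_self s.z).trans hu.2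
    have hy0 (j) : 0 ≤ d * s.x j / β := by
      have := (h.regular.pos j).le
      positivity
    set w := sampleWeight fun j => min 1 (d * s.x j / β) with hw
    have hw0 (R) : 0 ≤ w R :=
      sampleWeight_nonneg (fun j => le_min zero_le_one (hy0 j)) (fun j => min_le_left _ _) R
    have hnonneg (R) : 0 ≤ potential I β (locNext β backup s (I i) R) (U.erase i) := by
      refine Consistent.potential_nonneg ⟨hβ, h.le_lpOpt, h.regular.locNext hβ _ R, ?_⟩ _
      intro c hc
      rcases List.mem_cons.1 hc with rfl | hc
      · exact ⟨i, rfl⟩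
      · exact h.seen c hc
    have hsize : ∑ R, w R * (R.card : ℝ) ≤ d := by
      have h1 := sum_sampleWeight_card (fun j => min 1 (d * s.x j / β)) Finset.univ
      simp only [Finset.univ_inter] at h1
      rw [hw, h1]
      calc ∑ j, min 1 (d * s.x j / β) ≤ ∑ j, d * s.x j / β :=
            Finset.sum_le_sum fun j _ => min_le_right _ _
        _ = d := by
            rw [← Finset.sum_div, ← Finset.mul_sum, h.regular.sum_eq]
            field_simp
    set ρ := residual I β s U with hρ
    have hρ0 : 0 ≤ ρ := residual_nonneg s U
    have hcover : d / (4 * β) * ∑ k ∈ goodRows I β s U, truncWeight (I k) s ≤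
        ∑ R, w R * ∑ k ∈ goodRows I β s U,
          min (undercoverage (I k) s.z : ℝ) ((((I k).supp \ s.z) ∩ R).card : ℝ) := by
      simp_rw [Finset.mul_sum]
      rw [Finset.sum_comm]
      exact Finset.sum_le_sum fun k _ => h.regular.le_sum_sampleWeight_min hβ hd0 hdβ (I k)
    have hlin (a k : ℝ) (f g : Finset (Fin m) → ℝ) : ∑ R, w R * (a + f R - k * g R) =
        a + ∑ R, w R * f R - k * ∑ R, w R * g R := by
      have h1 : ∑ R, w R * (a + f R - k * g R) =
          (∑ R, w R) * a + ∑ R, w R * f R - k * ∑ R, w R * g R := by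
        rw [Finset.sum_mul, Finset.mul_sum, ← Finset.sum_add_distrib, ← Finset.sum_sub_distrib]
        refine Finset.sum_congr rfl fun R _ => ?_
        ring
      rw [h1, hw, sum_sampleWeight, one_mul]
    have hmain : ∑ R, w R * potential I β (locNext β backup s (I i) R) (U.erase i) ≤
        goodBound I β s U i := by
      calc ∑ R, w R * potential I β (locNext β backup s (I i) R) (U.erase i)
          ≤ ∑ R, w R * ((potential I β s U - d + 10 * truncWeight (I i) s) + R.card -
              80 * β / (1 + ρ) * ∑ k ∈ goodRows I β s U,
                min (undercoverage (I k) s.z : ℝ) ((((I k).supp \ s.z) ∩ R).card : ℝ)) :=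
            Finset.sum_le_sum fun R _ =>
              mul_le_mul_of_nonneg_left (potential_locNext_le hb hI h hi R) (hw0 R)
        _ = (potential I β s U - d + 10 * truncWeight (I i) s) + ∑ R, w R * (R.card : ℝ) -
              80 * β / (1 + ρ) * ∑ R, w R * ∑ k ∈ goodRows I β s U,
                min (undercoverage (I k) s.z : ℝ) ((((I k).supp \ s.z) ∩ R).card : ℝ) := by
            rw [hlin]
        _ ≤ (potential I β s U - d + 10 * truncWeight (I i) s) + d -
              80 * β / (1 + ρ) * (d / (4 * β) *
                ∑ k ∈ goodRows I β s U, truncWeight (I k) s) := by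
            gcongr
        _ = goodBound I β s U i := by
            rw [goodBound, ← hd, ← hρ]
            field_simp
            ring
    refine ⟨(Finset.sum_nonneg fun R _ => mul_nonneg (hw0 R) (hnonneg R)).trans hmain, ?_⟩
    rw [locStep_of_not_coveredBy hc, expect_map, ← hd, expect_sampleSet_ofReal hy0 hnonneg]
    exact ENNReal.ofReal_le_ofReal hmain

/-- Averaged over the next row, the potential does not increase. -/
theorem sum_le_card_mul_potential {s : LOCState m} (h : Consistent I β s) (U : Finset (Fin n))
    (e : Fin n → ℝ≥0∞)
    (hgood : ∀ i ∈ goodRows I β s U,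
      0 ≤ goodBound I β s U i ∧ e i ≤ ENNReal.ofReal (goodBound I β s U i))
    (hbad : ∀ i ∈ U, i ∉ goodRows I β s U → e i ≤ ENNReal.ofReal (potential I β s U)) :
    ∑ i ∈ U, e i ≤ U.card * ENNReal.ofReal (potential I β s U) := by
  classical
  set G := goodRows I β s U with hG
  have hGU : G ⊆ U := Finset.filter_subset _ _
  set ρ := residual I β s U with hρ
  set M := ∑ k ∈ G, truncWeight (I k) s with hM
  have hρ0 : 0 ≤ ρ := residual_nonneg s U
  have hM0 : 0 ≤ M := Finset.sum_nonneg fun k _ => h.regular.truncWeight_nonneg _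
  -- For `M > 0` this says `ρ ≥ 1`, which holds because `ρ` is an integer and `ρ ≥ M > 0`.
  have hMρ : 10 * M ≤ 20 * ρ * M / (1 + ρ) := by
    rcases eq_or_lt_of_le hM0 with h0 | hpos
    · rw [← h0]
      simp
    · have hle : M ≤ ρ := Finset.sum_le_sum fun k _ => min_le_left _ _
      have h1 : 1 ≤ ρ := by
        have hcast : ρ = ((∑ k ∈ G, undercoverage (I k) s.z : ℕ) : ℝ) := by
          rw [hρ, residual, Nat.cast_sum]
        have : 0 < ρ := by linarith
        rw [hcast] at this ⊢
        exact_mod_cast this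
      rw [le_div_iff₀ (by positivity)]
      nlinarith
  have hsum : ∑ i ∈ G, goodBound I β s U i ≤ G.card * potential I β s U := by
    have : ∑ i ∈ G, goodBound I β s U i =
        G.card * potential I β s U + 10 * M - 20 * ρ * M / (1 + ρ) := by
      unfold goodBound
      rw [← hG, ← hM, ← hρ, Finset.sum_sub_distrib, Finset.sum_add_distrib, Finset.sum_const,
        nsmul_eq_mul, ← Finset.mul_sum, ← Finset.sum_div, ← Finset.sum_mul, ← Finset.mul_sum]
      rfl
    linarith
  have hsumG : ∑ i ∈ G, e i ≤ G.card * ENNReal.ofReal (potential I β s U) := by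
    calc ∑ i ∈ G, e i ≤ ∑ i ∈ G, ENNReal.ofReal (goodBound I β s U i) :=
          Finset.sum_le_sum fun i hi => (hgood i hi).2
      _ = ENNReal.ofReal (∑ i ∈ G, goodBound I β s U i) :=
          (ENNReal.ofReal_sum_of_nonneg fun i hi => (hgood i hi).1).symm
      _ ≤ ENNReal.ofReal (G.card * potential I β s U) := ENNReal.ofReal_le_ofReal hsum
      _ = G.card * ENNReal.ofReal (potential I β s U) := by
          rw [ENNReal.ofReal_mul (Nat.cast_nonneg _), ENNReal.ofReal_natCast]
  have hsumB : ∑ i ∈ U \ G, e i ≤ (U \ G).card * ENNReal.ofReal (potential I β s U) := by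
    rw [← nsmul_eq_mul]
    exact Finset.sum_le_card_nsmul _ _ _ fun i hi =>
      hbad i (Finset.mem_sdiff.1 hi).1 (Finset.mem_sdiff.1 hi).2
  calc ∑ i ∈ U, e i = ∑ i ∈ U \ G, e i + ∑ i ∈ G, e i := (Finset.sum_sdiff hGU).symm
    _ ≤ (U \ G).card * ENNReal.ofReal (potential I β s U) +
          G.card * ENNReal.ofReal (potential I β s U) := add_le_add hsumB hsumG
    _ = U.card * ENNReal.ofReal (potential I β s U) := by
        rw [← add_mul, ← Nat.cast_add, Finset.card_sdiff_add_card_eq_card hGU]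

theorem one_le_log_one_add (hmn : 2 ≤ m * n) : 1 ≤ Real.log (1 + m * n) := by
  have h : (2 : ℝ) ≤ m * n := by exact_mod_cast hmn
  rw [Real.le_log_iff_exp_le (by linarith)]
  linarith [Real.exp_one_lt_d9]

theorem log_le_log_one_add (hmn : 2 ≤ m * n) : Real.log m ≤ Real.log (1 + m * n) := by
  have hm : 0 < m := Nat.pos_of_ne_zero (by rintro rfl; simp at hmn)
  have hn : 1 ≤ n := Nat.pos_of_ne_zero (by rintro rfl; simp at hmn)
  have hm' : (0 : ℝ) < m := by exact_mod_cast hm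
  have hn' : (1 : ℝ) ≤ n := by exact_mod_cast hn
  exact Real.log_le_log hm' (by nlinarith)

theorem log_one_add_le_two_mul (hmn : 2 ≤ m * n) :
    Real.log (1 + m * n) ≤ 2 * Real.log ((m : ℝ) * n) := by
  have h : (2 : ℝ) ≤ m * n := by exact_mod_cast hmn
  have h2 : (2 : ℝ) * Real.log ((m : ℝ) * n) = Real.log (((m : ℝ) * n) ^ 2) := by
    rw [Real.log_pow, Nat.cast_ofNat]
  rw [h2]
  exact Real.log_le_log (by linarith) (by nlinarith)

/-- The initial state of LearnOrCoverSMC. -/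
noncomputable def initialState (m : ℕ) (β : ℝ) : LOCState m :=
  { x := fun _ => β / m, z := ∅, hist := [] }

theorem regular_of_uniform (hm : 0 < m) (hβ : 0 < β) (h2 : β ≤ 2 * m) {s : LOCState m}
    (hs : s.x = fun _ => β / m) : Regular β s := by
  have hm' : (0 : ℝ) < m := by exact_mod_cast hm
  refine ⟨fun j => ?_, ?_, fun j _ => ?_⟩
  · rw [hs]
    positivity
  · rw [hs, Finset.sum_const, Finset.card_univ, Fintype.card_fin, nsmul_eq_mul]
    field_simp
  · rw [hs]
    exact (div_le_iff₀ hm').2 h2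

theorem consistent_initialState (hmn : 2 ≤ m * n) (hI : ∃ z, Feasible I z) (hβ : 0 < β)
    (hle : β ≤ 2 * lpOpt I) : Consistent I β (initialState m β) := by
  have hm : 0 < m := Nat.pos_of_ne_zero (by rintro rfl; simp at hmn)
  refine ⟨hβ, hle, regular_of_uniform hm hβ ?_ rfl, fun c hc => ?_⟩
  · linarith [lpOpt_le_columns hI]
  · simp [initialState, LOCState.seen] at hc

theorem coverPotential_le (hI : ∃ z, Feasible I z) (hβ : 0 < β) (s : LOCState m)
    (U : Finset (Fin n)) :
    β * Real.log (1 + residual I β s U) ≤ β * Real.log (1 + m * n) := by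
  have h0 := residual_nonneg (I := I) (β := β) s U
  have h1 := residual_le (β := β) hI s U
  exact mul_le_mul_of_nonneg_left (Real.log_le_log (by linarith) (by linarith)) hβ.le

/-- With `L = log (1 + mn)`, the two potentials are at most `85 β L`, and the reserve `86 L (4 LP -
2 β)` brings the total to at most `344 L LP`. Passing from `L` to `2 log (mn)` gives 688. -/
theorem potential_initialState_le (hmn : 2 ≤ m * n) (hI : ∃ z, Feasible I z) (hβ : 0 < β)
    (hle : β ≤ 2 * lpOpt I) :
    potential I β (initialState m β) Finset.univ ≤
      688 * Real.log ((m : ℝ) * (n : ℝ)) * (opt I : ℝ) := by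
  have hm : 0 < m := Nat.pos_of_ne_zero (by rintro rfl; simp at hmn)
  have hlearn : learnPotential β (initialState m β).seen (initialState m β).x ≤
    β * Real.log m := learnPotential_uniform_le hm hβ _
  have hlogm := mul_le_mul_of_nonneg_left (log_le_log_one_add hmn) hβ.le
  have hcov := coverPotential_le hI hβ (initialState m β) Finset.univ
  have hL0 := log_one_add_nonneg m n
  have hL := log_one_add_le_two_mul hmn
  have hopt := lpOpt_le_opt hI
  have hopt0 : (0 : ℝ) ≤ opt I := Nat.cast_nonneg _
  have hz : ((initialState m β).z.card : ℝ) = 0 := by simp [initialState]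
  have h1 := mul_le_mul_of_nonneg_right hle hL0
  have h2 := mul_le_mul_of_nonneg_right hopt hL0
  have h3 := mul_le_mul_of_nonneg_right hL hopt0
  have h4 : 0 ≤ Real.log (1 + m * n) * opt I := mul_nonneg hL0 hopt0
  have h5 := mul_nonneg hβ.le hL0
  unfold potential
  rw [hz]
  linarith

/-- Optimum zero is treated apart: the LP value is then 0, so no positive `β` satisfies `β ≤ 2 LP`
as `Consistent` demands. All requirements vanish and nothing is ever bought. -/
theorem expectedCost_eq_zero_of_opt_eq_zero (alg : OnlineAlg m) (hI : ∃ z, Feasible I z)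
    (h0 : opt I = 0) (Inv : alg.State → Prop) (hstart : Inv alg.start)
    (hsol : ∀ s, Inv s → alg.sol s = ∅)
    (hstep : ∀ s c, c.req = 0 → Inv s → ∀ s' ∈ (alg.step s c).support, Inv s') :
    alg.expectedCost I = 0 := by
  have hreq := req_eq_zero_of_opt_eq_zero hI h0
  refine le_antisymm (alg.expectedCost_le I Inv (fun _ _ => 0) hstart (fun s hs => ?_)
    (fun s i hs => hstep s _ (hreq i) hs) fun s U _ => ?_) bot_le
  · rw [hsol s hs]
    simp
  · simp [expect]

end Potential

/-! ### Part (a): a given estimate. -/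

section KnownEstimate

variable {m : ℕ} {β : ℝ} {backup : BackupRule m}

theorem learnOrCoverSMC_valid (hb : backup.Admissible) : (learnOrCoverSMC β backup).Valid :=
  OnlineAlg.valid_of_step _ (fun _ _ _ h => subset_of_mem_support_locStep h)
    fun _ _ hreq _ h => coveredBy_of_mem_support_locStep hb hreq h

theorem z_eq_empty_of_mem_support_locStep {s s' : LOCState m} {c : Constraint m}
    (hc : c.req = 0) (hs : s.z = ∅) (h : s' ∈ (locStep β backup s c).support) : s'.z = ∅ := by
  have hcov : c.CoveredBy s.z := by simp [Constraint.CoveredBy, hc]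
  rw [locStep_of_coveredBy hcov, PMF.support_pure, Set.mem_singleton_iff] at h
  rw [h]
  exact hs

variable {n : ℕ} {I : Instance m n}

theorem learnOrCoverSMC_expectedCost_le (hb : backup.Admissible) (hmn : 2 ≤ m * n)
    (hI : ∃ z, Feasible I z) (hle : lpOpt I ≤ β) (hle' : β ≤ 2 * lpOpt I) :
    (learnOrCoverSMC β backup).expectedCost I ≤
      ENNReal.ofReal (688 * Real.log ((m : ℝ) * (n : ℝ)) * (opt I : ℝ)) := by
  by_cases h0 : opt I = 0
  · refine le_of_eq_of_le (expectedCost_eq_zero_of_opt_eq_zero (learnOrCoverSMC β backup) hI h0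
      (fun s : LOCState m => s.z = ∅) rfl (fun s hs => hs) ?_) bot_le
    exact fun s c hc hs s' hs' => z_eq_empty_of_mem_support_locStep hc hs hs'
  have hβ : 0 < β := by linarith [one_le_lpOpt hI h0]
  have hstart := consistent_initialState hmn hI hβ hle'
  refine le_trans ((learnOrCoverSMC β backup).expectedCost_le I (Consistent I β)
    (fun s U => ENNReal.ofReal (potential I β s U)) hstart (fun s hs => ?_)
    (fun s i hs s' hs' => hs.of_mem_support_locStep hs') fun s U hs => ?_)
    (ENNReal.ofReal_le_ofReal (potential_initialState_le hmn hI hβ hle'))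
  · rw [← ENNReal.ofReal_natCast]
    exact ENNReal.ofReal_le_ofReal (hs.card_le_potential ∅)
  · refine sum_le_card_mul_potential hs U _
      (fun i hi => expect_locStep_potential_le hb hI hs hi) fun i hi hbad => ?_
    -- No row is bad: an optimal LP solution has weight at most `β` and covers every row.
    refine absurd (mem_goodRows.2 ⟨hi, ?_⟩) hbad
    obtain ⟨x, hx, hsum⟩ := exists_lpFeasible_sum_eq_lpOpt hI
    refine ⟨x, hx.fracCover fun c hc => ?_, hsum.trans_le hle⟩
    rcases List.mem_cons.1 hc with rfl | hc
    · exact ⟨i, rfl⟩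
    · exact hs.seen c hc

end KnownEstimate

/-! ### Part (b): restarts with growing estimates. -/

section UnknownEstimate

variable {m : ℕ} {backup : BackupRule m}

open Classical in
/-- A backup rule that makes an arbitrary choice. -/
noncomputable def someBackup (m : ℕ) : BackupRule m := fun _ T d =>
  if h : d ≤ T.card then (Finset.exists_subset_card_eq h).choose else ∅

theorem someBackup_admissible (m : ℕ) : (someBackup m).Admissible := fun _ T d h => by
  rw [someBackup, dif_pos h]
  exact (Finset.exists_subset_card_eq h).choose_spec

/-- Start a new phase: the arriving constraint is covered by backup columns, the new estimate is
twice the value of the linear program seen so far, and the fractional solution becomes uniform. -/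
noncomputable def restart (backup : BackupRule m) (s : LOCState m) (c : Constraint m) :
    ℝ × LOCState m :=
  (2 * lpValue (c :: s.seen),
    { x := fun _ => 2 * lpValue (c :: s.seen) / m
      z := s.z ∪ backup s.hist (c.supp \ s.z) (undercoverage c s.z)
      hist := (c, ∅) :: s.hist })

open Classical in
/-- One round of the algorithm that maintains its own estimate of the linear programming value. -/
noncomputable def adaptiveStep (backup : BackupRule m) (p : ℝ × LOCState m) (c : Constraint m) :
    PMF (ℝ × LOCState m) :=
  if (coversWithin p.1 (c :: p.2.seen)).Nonempty then
    (locStep p.1 backup p.2 c).map (Prod.mk p.1)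
  else PMF.pure (restart backup p.2 c)

/-- LearnOrCoverSMC with restarts whenever the linear program of the revealed rows outgrows the
current estimate. -/
noncomputable def adaptiveLearnOrCover (backup : BackupRule m) : OnlineAlg m where
  State := ℝ × LOCState m
  start := (1, initialState m 1)
  step := adaptiveStep backup
  sol := fun p => p.2.z

theorem mem_support_adaptiveStep {p p' : ℝ × LOCState m} {c : Constraint m}
    (h : p' ∈ (adaptiveStep backup p c).support) :
    (p'.1 = p.1 ∧ p'.2 ∈ (locStep p.1 backup p.2 c).support) ∨
      (¬ (coversWithin p.1 (c :: p.2.seen)).Nonempty ∧ p' = restart backup p.2 c) := by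
  unfold adaptiveStep at h
  split_ifs at h with hc
  · rw [PMF.support_map] at h
    obtain ⟨s', hs', rfl⟩ := h
    exact Or.inl ⟨rfl, hs'⟩
  · rw [PMF.support_pure, Set.mem_singleton_iff] at h
    exact Or.inr ⟨hc, h⟩

theorem adaptiveLearnOrCover_valid (hb : backup.Admissible) :
    (adaptiveLearnOrCover backup).Valid := by
  refine OnlineAlg.valid_of_step _ (fun p c p' h => ?_) fun p c hreq p' h => ?_
  · rcases mem_support_adaptiveStep h with ⟨-, h⟩ | ⟨-, rfl⟩
    · exact subset_of_mem_support_locStep h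
    · exact Finset.subset_union_left
  · rcases mem_support_adaptiveStep h with ⟨-, h⟩ | ⟨-, rfl⟩
    · exact coveredBy_of_mem_support_locStep hb hreq h
    · exact coveredBy_union_backup hb hreq (Finset.Subset.refl _) _

variable {n : ℕ} {I : Instance m n}

/-- When a row pushes the linear program above the estimate `β`, its value is at least `β`. -/
theorem Consistent.le_lpValue_of_not_nonempty {β : ℝ} {s : LOCState m} (h : Consistent I β s)
    (hI : ∃ z, Feasible I z) {i : Fin n}
    (hbad : ¬ (coversWithin β (I i :: s.seen)).Nonempty) :
    β ≤ lpValue (I i :: s.seen) ∧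
      (undercoverage (I i) s.z : ℝ) ≤ lpValue (I i :: s.seen) ∧
      lpValue (I i :: s.seen) ≤ lpOpt I := by
  have hcs : ∀ c ∈ I i :: s.seen, ∃ k, c = I k := fun c hc => by
    rcases List.mem_cons.1 hc with rfl | hc
    · exact ⟨i, rfl⟩
    · exact h.seen c hc
  refine ⟨le_lpValue hI hcs fun x hx => ?_,
    le_lpValue hI hcs fun x hx => hx.undercoverage_le_sum List.mem_cons_self s.z,
    lpValue_le_lpOpt hI hcs⟩
  by_contra! hlt
  exact hbad ⟨x, hx, hlt.le⟩

theorem Consistent.restart {β : ℝ} {s : LOCState m} (h : Consistent I β s) (hmn : 2 ≤ m * n)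
    (hI : ∃ z, Feasible I z) {i : Fin n}
    (hbad : ¬ (coversWithin β (I i :: s.seen)).Nonempty) :
    Consistent I (restart backup s (I i)).1 (restart backup s (I i)).2 := by
  obtain ⟨h1, -, h2⟩ := h.le_lpValue_of_not_nonempty hI hbad
  have hm : 0 < m := Nat.pos_of_ne_zero (by rintro rfl; simp at hmn)
  have hpos : 0 < 2 * lpValue (I i :: s.seen) := by linarith [h.pos]
  refine ⟨hpos, mul_le_mul_of_nonneg_left h2 zero_le_two, regular_of_uniform hm hpos ?_ rfl,
    fun c hc => ?_⟩
  · linarith [lpOpt_le_columns hI]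
  · rcases List.mem_cons.1 hc with rfl | hc
    · exact ⟨i, rfl⟩
    · exact h.seen c hc

/-- Let `β'` be the new estimate and `L = log (1 + mn)`. As `β' ≥ 2 β`, the reserve falls by `172 L
(β' - β) ≥ 86 L β'`. This pays at most `85 L β'` for the fresh potentials and the backup cost, at
most `β' / 2 ≤ L β'`. The set `U'` is arbitrary since the covering term is bounded by its maximum.
-/
theorem potential_restart_le (hb : backup.Admissible) {β : ℝ} {s : LOCState m}
    (h : Consistent I β s) (hmn : 2 ≤ m * n) (hI : ∃ z, Feasible I z) {i : Fin n}
    (hbad : ¬ (coversWithin β (I i :: s.seen)).Nonempty) (U U' : Finset (Fin n)) :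
    potential I (restart backup s (I i)).1 (restart backup s (I i)).2 U' ≤
      potential I β s U := by
  obtain ⟨h1, hd, -⟩ := h.le_lpValue_of_not_nonempty hI hbad
  have hm : 0 < m := Nat.pos_of_ne_zero (by rintro rfl; simp at hmn)
  have hpos := (h.restart (backup := backup) hmn hI hbad).pos
  set p := restart backup s (I i) with hp
  have hp1 : p.1 = 2 * lpValue (I i :: s.seen) := rfl
  have hcard : (p.2.z.card : ℝ) ≤ s.z.card + undercoverage (I i) s.z := by
    obtain ⟨z, hz⟩ := hI
    have h2 := (hb s.hist _ _ (undercoverage_le_card (hz.req_le i) s.z)).2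
    have h3 := Finset.card_union_le s.z
      (backup s.hist ((I i).supp \ s.z) (undercoverage (I i) s.z))
    rw [h2] at h3
    exact_mod_cast h3
  have hlearn : learnPotential p.1 p.2.seen p.2.x ≤ p.1 * Real.log m :=
    learnPotential_uniform_le hm hpos _
  have hlogm := mul_le_mul_of_nonneg_left (log_le_log_one_add hmn) hpos.le
  have hcov := coverPotential_le hI hpos p.2 U'
  have hlearn0 := learnPotential_nonneg s.seen h.regular.pos h.regular.sum_eq
  have hcov0 : 0 ≤ β * Real.log (1 + residual I β s U) :=
    mul_nonneg h.pos.le (Real.log_nonneg (by linarith [residual_nonneg (I := I) (β := β) s U]))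
  have hL := mul_le_mul_of_nonneg_left (one_le_log_one_add hmn) hpos.le
  have hgrow : 2 * (β * Real.log (1 + m * n)) ≤ p.1 * Real.log (1 + m * n) := by
    rw [← mul_assoc]
    exact mul_le_mul_of_nonneg_right (by linarith) (log_one_add_nonneg m n)
  unfold potential
  linarith

theorem adaptiveLearnOrCover_expectedCost_le (hb : backup.Admissible) (hmn : 2 ≤ m * n)
    (hI : ∃ z, Feasible I z) :
    (adaptiveLearnOrCover backup).expectedCost I ≤
      ENNReal.ofReal (688 * Real.log ((m : ℝ) * (n : ℝ)) * (opt I : ℝ)) := by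
  by_cases h0 : opt I = 0
  · refine le_of_eq_of_le (expectedCost_eq_zero_of_opt_eq_zero (adaptiveLearnOrCover backup) hI
      h0 (fun p : ℝ × LOCState m => p.2.z = ∅) rfl (fun p hp => hp) ?_) bot_le
    intro p c hc hp p' hp'
    rcases mem_support_adaptiveStep hp' with ⟨-, h⟩ | ⟨-, rfl⟩
    · exact z_eq_empty_of_mem_support_locStep hc hp h
    · have h1 : undercoverage c p.2.z = 0 := by simp [undercoverage, hc]
      have h2 := (hb p.2.hist (c.supp \ p.2.z) 0 (Nat.zero_le _)).2
      rw [Finset.card_eq_zero] at h2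
      change p.2.z ∪ backup p.2.hist (c.supp \ p.2.z) (undercoverage c p.2.z) = ∅
      have hp : p.2.z = ∅ := hp
      rw [h1, h2, hp, Finset.union_empty]
  -- The starting estimate 1 is admissible because a nonzero optimum forces the LP value to be at
  -- least 1.
  have hle : (1 : ℝ) ≤ 2 * lpOpt I := by linarith [one_le_lpOpt hI h0]
  have hstart := consistent_initialState hmn hI zero_lt_one hle
  have hstep (p : ℝ × LOCState m) (U : Finset (Fin n)) (hp : Consistent I p.1 p.2) :
      ∑ i ∈ U, expect (adaptiveStep backup p (I i))
        (fun p' => ENNReal.ofReal (potential I p'.1 p'.2 (U.erase i))) ≤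
          U.card * ENNReal.ofReal (potential I p.1 p.2 U) := by
    refine sum_le_card_mul_potential hp U _ (fun i hi => ?_) fun i hi hbad => ?_
    · rw [adaptiveStep, if_pos (mem_goodRows.1 hi).2, expect_map]
      exact expect_locStep_potential_le hb hI hp hi
    · have hbad' : ¬ (coversWithin p.1 (I i :: p.2.seen)).Nonempty := fun hne =>
        hbad (mem_goodRows.2 ⟨hi, hne⟩)
      rw [adaptiveStep, if_neg hbad', expect_pure]
      exact ENNReal.ofReal_le_ofReal (potential_restart_le hb hp hmn hI hbad' U _)
  refine le_trans ((adaptiveLearnOrCover backup).expectedCost_le I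
    (fun p : ℝ × LOCState m => Consistent I p.1 p.2)
    (fun (p : ℝ × LOCState m) U => ENNReal.ofReal (potential I p.1 p.2 U)) hstart
    (fun p hp => ?_) (fun p i hp p' hp' => ?_) hstep)
    (ENNReal.ofReal_le_ofReal (potential_initialState_le hmn hI zero_lt_one hle))
  · rw [← ENNReal.ofReal_natCast]
    exact ENNReal.ofReal_le_ofReal (hp.card_le_potential ∅)
  · rcases mem_support_adaptiveStep hp' with ⟨h1, h⟩ | ⟨hbad, rfl⟩
    · rw [h1]
      exact hp.of_mem_support_locStep h
    · exact hp.restart hmn hI hbad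

end UnknownEstimate
end SetMulticover

theorem mainTheorem8 :
    -- LearnOrCoverSMC, run with any estimate `β` of the linear programming value up to a factor
    -- two and with any choice of backup columns
    (∃ C : ℝ, 0 < C ∧
      ∀ (m : ℕ) (β : ℝ) (backup : SetMulticover.BackupRule m), backup.Admissible →
        (SetMulticover.learnOrCoverSMC β backup).Valid ∧
        ∀ (n : ℕ), 2 ≤ m * n →
          ∀ I : SetMulticover.Instance m n, (∃ z, SetMulticover.Feasible I z) →
            SetMulticover.lpOpt I ≤ β → β ≤ 2 * SetMulticover.lpOpt I →
            (SetMulticover.learnOrCoverSMC β backup).expectedCost I ≤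
              ENNReal.ofReal (C * Real.log ((m : ℝ) * (n : ℝ)) * (SetMulticover.opt I : ℝ))) ∧
    -- a competitive algorithm that is given no estimate and does not know the instance in advance
    (∃ C : ℝ, 0 < C ∧
      ∀ m : ℕ, ∃ alg : SetMulticover.OnlineAlg m, alg.Valid ∧
        ∀ (n : ℕ), 2 ≤ m * n →
          ∀ I : SetMulticover.Instance m n, (∃ z, SetMulticover.Feasible I z) →
            alg.expectedCost I ≤
              ENNReal.ofReal (C * Real.log ((m : ℝ) * (n : ℝ)) * (SetMulticover.opt I : ℝ))) :=
  ⟨⟨688, by norm_num, fun _ _ _ hb => ⟨SetMulticover.learnOrCoverSMC_valid hb,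
    fun _ hmn _ hI hle hle' =>
      SetMulticover.learnOrCoverSMC_expectedCost_le hb hmn hI hle hle'⟩⟩,
   ⟨688, by norm_num, fun m => ⟨SetMulticover.adaptiveLearnOrCover (SetMulticover.someBackup m),
    SetMulticover.adaptiveLearnOrCover_valid (SetMulticover.someBackup_admissible m),
    fun _ hmn _ hI => SetMulticover.adaptiveLearnOrCover_expectedCost_le
      (SetMulticover.someBackup_admissible m) hmn hI⟩⟩⟩
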